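/- Let $X$ be a proper (equivalently, locally finite) CAT(0) cube complex, i.e. a simply connected cube complex in which the link of every vertex is a simplicial flag complex, and let a group $G$ act properly and cocompactly on $X$ by cubical automorphisms. A subcomplex is convex if it is nonempty, full (it contains every cube whose vertices it contains), and its $1$-skeleton contains every combinatorial geodesic of $X^{(1)}$ joining two of its vertices. Two convex subcomplexes are parallel if they are crossed by exactly the same hyperplanes of $X$. For a convex subcomplex $Y$, the gate map $\mathfrak g_Y\colon X\to Y$ is the cubical map that sends each vertex to the closest vertex of $Y$. The combinatorial hyperplanes are the two subcomplexes $H\times\{\pm\frac12\}$ bounding the carrier $H\times[-\frac12,\frac12]$ of a hyperplane $H$. Let $\mathfrak F$ be the hyperclosure of $X$, i.e. the intersection of all sets $\mathfrak F'$ of convex subcomplexes such that (1) $X\in\mathfrak F'$ and every combinatorial hyperplane is in $\mathfrak F'$; (2) if $F,F'\in\mathfrak F'$ then $\mathfrak g_F(F')\in\mathfrak F'$; (3) every convex subcomplex parallel to an element of $\mathfrak F'$ is in $\mathfrak F'$. Suppose that $\mathfrak F$ is a factor system, i.e. there is $\xi<\infty$ such that every $x\in X$ lies in at most $\xi$ elements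 of $\mathfrak F$. Let $F\in\mathfrak F$ and let $V\in\mathfrak F$ be properly contained in $F$. Then there exists $U\in\mathfrak F$, unique up to parallelism, such that: (i) $U\subset F$; (ii) the inclusion $V\hookrightarrow F$ extends to a convex embedding $V\times U\hookrightarrow F$, that is, there is an isomorphism of cube complexes $\phi$ from $V\times U$ onto a convex subcomplex of $X$ contained in $F$ such that $\phi(\cdot,u_0)$ is the inclusion of $V$ for some vertex $u_0\in U$, and $\phi(\{v\}\times U)$ is parallel to $U$ for every vertex $v\in V$; (iii) if $W\in\mathfrak F$ and (i) and (ii) hold with $U$ replaced by $W$, then $W$ is parallel to a subcomplex of $U$. -/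

import Mathlib

/-- A face of the standard `n`-cube, on the level of its vertex set `{0,1}^n`: some coordinates
are fixed, the others are free. -/
def IsCubeFace {n : ℕ} (s : Set (Fin n → Bool)) : Prop :=
  ∃ (J : Set (Fin n)) (a : Fin n → Bool), s = {x | ∀ i ∈ J, x i = a i}

/-- A cube complex with set of `0`-cubes `α`. A cube is recorded by its set of `0`-cubes.
Each cube is parametrized injectively by a standard cube, in such a way that the cubes contained
in it are exactly its faces, and two cubes that meet do so in a common face (`C ∩ D` is a cube
contained in `C` and in `D`, hence a face of both). -/
structure CubeComplex (α : Type*) where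
  /-- The vertex sets of the cubes. -/
  cubes : Set (Set α)
  singleton_mem : ∀ v : α, {v} ∈ cubes
  exists_chart : ∀ C ∈ cubes, ∃ (n : ℕ) (f : (Fin n → Bool) → α),
    Function.Injective f ∧ Set.range f = C ∧
      ∀ D ⊆ C, D ∈ cubes ↔ ∃ s, IsCubeFace s ∧ D = f '' s
  inter_mem : ∀ C ∈ cubes, ∀ D ∈ cubes, (C ∩ D).Nonempty → C ∩ D ∈ cubes

namespace CubeComplex

variable {α : Type*} (X : CubeComplex α)

/-- The `1`-skeleton. -/
def graph : SimpleGraph α :=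
  SimpleGraph.fromRel fun a b => ({a, b} : Set α) ∈ X.cubes

/-- `a, b, c, d` are, in this cyclic order, the vertices of a `2`-cube. -/
def Square (a b c d : α) : Prop :=
  ({a, b, c, d} : Set α) ∈ X.cubes ∧
    X.graph.Adj a b ∧ X.graph.Adj b c ∧ X.graph.Adj c d ∧ X.graph.Adj d a ∧ a ≠ c ∧ b ≠ d

/-- Homotopy of edge paths with fixed endpoints: the congruence generated by deleting
backtracks and by pushing a path across a `2`-cube. -/
inductive PathHomotopic : ∀ {u v : α}, X.graph.Walk u v → X.graph.Walk u v → Prop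
  | refl {u v : α} (p : X.graph.Walk u v) : PathHomotopic p p
  | symm {u v : α} {p q : X.graph.Walk u v} : PathHomotopic p q → PathHomotopic q p
  | trans {u v : α} {p q r : X.graph.Walk u v} :
      PathHomotopic p q → PathHomotopic q r → PathHomotopic p r
  | cons {u v w : α} (h : X.graph.Adj u v) {p q : X.graph.Walk v w} :
      PathHomotopic p q →
        PathHomotopic (SimpleGraph.Walk.cons h p) (SimpleGraph.Walk.cons h q)
  | backtrack {u v w : α} (h : X.graph.Adj u v) (p : X.graph.Walk u w) :
      PathHomotopic (SimpleGraph.Walk.cons h (SimpleGraph.Walk.cons h.symm p)) p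
  | square {a b c d w : α} (hab : X.graph.Adj a b) (hbc : X.graph.Adj b c)
      (had : X.graph.Adj a d) (hdc : X.graph.Adj d c) (p : X.graph.Walk c w) :
      X.Square a b c d →
        PathHomotopic (SimpleGraph.Walk.cons hab (SimpleGraph.Walk.cons hbc p))
          (SimpleGraph.Walk.cons had (SimpleGraph.Walk.cons hdc p))

/-- Connected (in particular nonempty), with trivial edge-path fundamental group. -/
def SimplyConnected : Prop :=
  X.graph.Connected ∧
    ∀ (v : α) (p : X.graph.Walk v v), X.PathHomotopic p SimpleGraph.Walk.nil

/-- The link of the `0`-cube `v`, as a family of simplices. Its vertices are the `1`-cubes at `v`,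
recorded by their other endpoints, and a cube `C` containing `v` contributes the simplex spanned
by the `1`-cubes of `C` at `v`. -/
def link (v : α) : Set (Set α) :=
  {S | ∃ C ∈ X.cubes, v ∈ C ∧ S = {w | w ∈ C ∧ X.graph.Adj v w}}

/-- The link of every `0`-cube is a flag complex: finitely many vertices that pairwise span
simplices span a simplex (the case `s = t` says that `s` is a vertex of the link). -/
def FlagLinks : Prop :=
  ∀ (v : α) (S : Set α), S.Finite →
    (∀ s ∈ S, ∀ t ∈ S, ({s, t} : Set α) ∈ X.link v) → S ∈ X.link v

/-- A CAT(0) cube complex: simply connected, and all links of `0`-cubes are flag. -/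
structure IsCAT0 : Prop where
  simplyConnected : X.SimplyConnected
  flagLinks : X.FlagLinks

/-- Properness of a cube complex: every `0`-cube lies in finitely many cubes. -/
def IsProper : Prop :=
  ∀ v : α, {C | C ∈ X.cubes ∧ v ∈ C}.Finite

/-- `G` acts by cubical automorphisms, properly and cocompactly. -/
structure ActsGeometrically (G : Type*) [Group G] [MulAction G α] : Prop where
  map_cubes : ∀ (g : G), ∀ C ∈ X.cubes, (fun v => g • v) '' C ∈ X.cubes
  proper : ∀ S : Set α, S.Finite → {g : G | (((fun v => g • v) '' S) ∩ S).Nonempty}.Finite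
  cocompact : ∃ K : Set (Set α), K.Finite ∧ K ⊆ X.cubes ∧
    ∀ C ∈ X.cubes, ∃ D ∈ K, ∃ g : G, C = (fun v => g • v) '' D

/-- `A` is (the set of `0`-cubes of) a nonempty convex subcomplex. Convex subcomplexes are full,
i.e. contain each cube whose `0`-cubes they contain, so that they are recorded by their sets of
`0`-cubes; the condition is that every combinatorial geodesic with endpoints in `A` stays in
`A`. -/
def ConvexSubcomplex (A : Set α) : Prop :=
  A.Nonempty ∧ ∀ a ∈ A, ∀ b ∈ A, ∀ w : α,
    X.graph.dist a w + X.graph.dist w b = X.graph.dist a b → w ∈ A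

/-- Parallelism of oriented `1`-cubes: the equivalence relation that identifies opposite
sides of a `2`-cube, with matching orientations. -/
def OrientedParallel : α × α → α × α → Prop :=
  Relation.EqvGen fun e f => X.Square e.1 e.2 f.2 f.1

/-- The hyperplane dual to the `1`-cube `{a, b}`, recorded by the set of all `1`-cubes that it
crosses. -/
def hyperplane (a b : α) : Set (Sym2 α) :=
  {s | ∃ e : α × α, X.OrientedParallel (a, b) e ∧ s = s(e.1, e.2)}

/-- The set of all hyperplanes. -/
def hyperplanes : Set (Set (Sym2 α)) :=
  {H | ∃ a b : α, X.graph.Adj a b ∧ H = X.hyperplane a b}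

/-- The combinatorial hyperplane bounding the carrier of the hyperplane dual to `{a, b}`, on the
side of `a`: it consists of the initial points of the oriented `1`-cubes parallel to `(a, b)`.
The other one is `X.combinatorialHyperplane b a`. -/
def combinatorialHyperplane (a b : α) : Set α :=
  {v | ∃ w : α, X.OrientedParallel (a, b) (v, w)}

/-- The hyperplane `H` crosses the full subcomplex on `A`, i.e. is dual to one of its
`1`-cubes. -/
def Crosses (H : Set (Sym2 α)) (A : Set α) : Prop :=
  ∃ a ∈ A, ∃ b ∈ A, s(a, b) ∈ H

/-- Convex subcomplexes are parallel if they are crossed by the same hyperplanes. -/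
def Parallel (A B : Set α) : Prop :=
  ∀ H ∈ X.hyperplanes, Crosses H A ↔ Crosses H B

/-- `A` is parallel to a (convex) subcomplex of `B`. -/
def ParallelInto (A B : Set α) : Prop :=
  ∃ B' ⊆ B, X.ConvexSubcomplex B' ∧ X.Parallel A B'

/-- The image of `B` under the gate map to `A`, which sends each `0`-cube to the closest `0`-cube
of `A`. -/
def gateImage (A B : Set α) : Set α :=
  {y | y ∈ A ∧ ∃ x ∈ B, ∀ z ∈ A, X.graph.dist x y ≤ X.graph.dist x z}

/-- A set of convex subcomplexes that contains `X` and all combinatorial hyperplanes and is closed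
under gate projections and under parallelism. -/
structure IsHyperclosed (𝓕 : Set (Set α)) : Prop where
  convex : ∀ A ∈ 𝓕, X.ConvexSubcomplex A
  univ_mem : Set.univ ∈ 𝓕
  combinatorialHyperplane_mem :
    ∀ a b : α, X.graph.Adj a b → X.combinatorialHyperplane a b ∈ 𝓕
  gateImage_mem : ∀ A ∈ 𝓕, ∀ B ∈ 𝓕, X.gateImage A B ∈ 𝓕
  parallel_mem : ∀ A ∈ 𝓕, ∀ B, X.ConvexSubcomplex B → X.Parallel B A → B ∈ 𝓕

/-- The hyperclosure: the intersection of all hyperclosed sets of convex subcomplexes. -/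
def hyperclosure : Set (Set α) :=
  {A | ∀ 𝓕 : Set (Set α), X.IsHyperclosed 𝓕 → A ∈ 𝓕}

/-- The hyperclosure is a factor system: it has uniformly finite multiplicity. (A subcomplex
contains a point of `X` only if it contains the smallest cube through that point, so it is enough
to count at `0`-cubes.) -/
def HasFactorSystem : Prop :=
  ∃ ξ : ℕ, ∀ x : α, {A | A ∈ X.hyperclosure ∧ x ∈ A}.encard ≤ (ξ : ℕ∞)

/-- `φ` is an isomorphism of the product cube complex `A × B` (whose cubes are the products of a
cube of `A` and a cube of `B`) onto a convex subcomplex that is contained in `F`. -/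
structure IsConvexProductEmbedding (A B F : Set α) (φ : α × α → α) : Prop where
  injOn : Set.InjOn φ (A ×ˢ B)
  image_mem_cubes_iff : ∀ S ⊆ A ×ˢ B,
    φ '' S ∈ X.cubes ↔ ∃ C ∈ X.cubes, ∃ D ∈ X.cubes, S = C ×ˢ D
  convex_image : X.ConvexSubcomplex (φ '' (A ×ˢ B))
  image_subset : φ '' (A ×ˢ B) ⊆ F

/-- The inclusion of `A` in `F` extends to a convex embedding `A × B → F`: it is the restriction
to some slice `A × {b}`, and the slices `{a} × B` are sent to parallel copies of the given
subcomplex `B`. -/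
def ExtendsToProduct (A B F : Set α) : Prop :=
  ∃ φ : α × α → α, X.IsConvexProductEmbedding A B F φ ∧
    (∃ b ∈ B, ∀ a ∈ A, φ (a, b) = a) ∧
    ∀ a ∈ A, X.Parallel (φ '' ({a} ×ˢ B)) B

/-- `U` belongs to the hyperclosure, lies in `F`, the inclusion of `V` extends to a convex
embedding `V × U → F`, and every `W` with these properties is parallel to a subcomplex of `U`. -/
structure IsCleanContainer (F V U : Set α) : Prop where
  mem : U ∈ X.hyperclosure
  subset : U ⊆ F
  extends_product : X.ExtendsToProduct V U F
  maximal : ∀ W ∈ X.hyperclosure, W ⊆ F → X.ExtendsToProduct V W F → X.ParallelInto W U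

end CubeComplex

/-!
The proof is carried out with halfspaces. For an edge `ab` the halfspace `side a b` consists of the
vertices closer to `a` than to `b`, and a halfspace `K` *cuts* a set if both `K` and its complement
meet the set. Convex subcomplexes are parallel if and only if they are cut by the same halfspaces
(`parallel_iff`).

Everything rests on the quadrangle condition `IsCAT0.quadrangle`, which is deduced from simple
connectivity and flagness by a normal form argument. Edge paths from a base point are considered
up to pushing them across squares. The cube condition shows that two equivalent paths with different
last edges differ, up to equivalence, by one square at the end (`SquareEquiv.lastStep`). Hence edges
act on reduced paths by appending or cancelling, homotopic walks act in the same way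
(`PathHomotopic.run`), and so each vertex is reached by only one class of reduced paths, which
consists of the geodesics. The quadrangle condition then yields the standard facts: halfspaces are
convex and are bounded by the hyperplanes, convex subcomplexes have gates and are intersections of
halfspaces, and Helly's theorem holds.

For `x ∈ V` let `orthogonal V x` be the set of vertices that are separated from `x` only by
hyperplanes crossing all hyperplanes of `V`. It is convex, and it is cut precisely by the
hyperplanes that cross all hyperplanes of `V` (`cuts_orthogonal_iff`). It belongs to the
hyperclosure (`orthogonal_mem_hyperclosure`): starting with the whole complex, one takes gate images
of combinatorial hyperplanes dual to edges of `V` until only the hyperplanes of the complement are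
left, which happens after finitely many steps because a factor system has no infinite descending
chains. The container is `U = orthogonal V x ∩ F`. All hyperplanes of `V` cross all hyperplanes of
`U`, so `V` and `U` span a product region (`IsProductMap.extendsToProduct`); its cubes are
identified by the description of cubes as convex sets whose hyperplanes pairwise cross
(`mem_cubes_iff`).
Conversely, if `V × W` embeds in `F`, then all hyperplanes of `W` cut `F` and cross all hyperplanes
of `V`, so they cut `U`, and `W` is parallel to its gate image in `U`. Uniqueness up to parallelism
is immediate from maximality.
-/

namespace CubeComplex

variable {α : Type*} {X : CubeComplex α} {a b c d : α}

/-! ### Squares and cubes -/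

theorem adj_iff : X.graph.Adj a b ↔ a ≠ b ∧ ({a, b} : Set α) ∈ X.cubes := by
  simp [graph, Set.pair_comm b a]

theorem Square.rotate (h : X.Square a b c d) : X.Square b c d a := by
  obtain ⟨h, h1, h2, h3, h4, h5, h6⟩ := h
  refine ⟨?_, h2, h3, h4, h1, h6, h5.symm⟩
  convert h using 1
  ext; simp; tauto

theorem Square.reflect (h : X.Square a b c d) : X.Square a d c b := by
  obtain ⟨h, h1, h2, h3, h4, h5, h6⟩ := h
  refine ⟨?_, h4.symm, h3.symm, h2.symm, h1.symm, h5, h6.symm⟩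
  convert h using 1
  ext; simp; tauto

theorem ncard_ne_three {C : Set α} (hC : C ∈ X.cubes) : C.ncard ≠ 3 := by
  obtain ⟨n, f, hf, rfl, -⟩ := X.exists_chart C hC
  rw [← Set.image_univ, Set.ncard_image_of_injective _ hf, Set.ncard_univ]
  simp only [Nat.card_eq_fintype_card, Fintype.card_fun, Fintype.card_bool, Fintype.card_fin]
  intro h
  cases n with
  | zero => simp at h
  | succ n => rw [pow_succ] at h; omega

/-- Two edges at a vertex span at most one square: two squares that share three vertices have the
same vertices, because their intersection is a cube and so does not have exactly three. -/
theorem Square.unique {d' : α} (h : X.Square a b c d) (h' : X.Square a b c d') : d = d' := by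
  by_contra hne
  have hm := X.inter_mem _ h.1 _ h'.1 ⟨a, by simp⟩
  have hab := h.2.1.ne
  have hbc := h.2.2.1.ne
  have hcd := h.2.2.2.1.ne
  have hda := h.2.2.2.2.1.ne
  have hac := h.2.2.2.2.2.1
  have hbd := h.2.2.2.2.2.2
  have he : ({a, b, c, d} ∩ {a, b, c, d'} : Set α) = {a, b, c} := by
    ext z
    simp only [Set.mem_inter_iff, Set.mem_insert_iff, Set.mem_singleton_iff]
    constructor
    · rintro ⟨h1, h2⟩
      by_contra! h3
      have e1 : z = d := by tauto
      have e2 : z = d' := by tauto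
      exact hne (e1.symm.trans e2)
    · tauto
  rw [he] at hm
  exact ncard_ne_three hm (Set.ncard_eq_three.2 ⟨a, b, c, hab, hac, hbc, rfl⟩)

/-- The vertex of the standard cube that differs from `x` exactly in the coordinate `i`. -/
def flip {n : ℕ} (i : Fin n) (x : Fin n → Bool) : Fin n → Bool :=
  Function.update x i (!x i)

theorem flip_same {n : ℕ} (i : Fin n) (x : Fin n → Bool) : flip i x i = !x i := by simp [flip]

theorem flip_of_ne {n : ℕ} {i j : Fin n} (h : j ≠ i) (x : Fin n → Bool) : flip i x j = x j := by
  simp [flip, h]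

theorem flip_ne {n : ℕ} (i : Fin n) (x : Fin n → Bool) : flip i x ≠ x := by
  intro h
  have := congrFun h i
  simp [flip_same] at this

theorem flip_comm {n : ℕ} (i j : Fin n) (x : Fin n → Bool) :
    flip i (flip j x) = flip j (flip i x) := by
  ext k
  by_cases hi : k = i <;> by_cases hj : k = j <;> (try subst hi) <;> (try subst hj) <;>
    simp_all [flip_same, flip_of_ne]

theorem flip_flip {n : ℕ} (i : Fin n) (x : Fin n → Bool) : flip i (flip i x) = x := by
  ext k
  by_cases hi : k = i
  · subst hi; simp [flip_same]
  · simp [flip_of_ne hi]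

/-- `f` parametrizes the cube `C` in such a way that the cubes contained in `C` are the images of
the faces. -/
structure IsChart (X : CubeComplex α) (C : Set α) {n : ℕ} (f : (Fin n → Bool) → α) : Prop where
  inj : Function.Injective f
  range_eq : Set.range f = C
  mem_cubes_iff : ∀ D ⊆ C, D ∈ X.cubes ↔ ∃ s, IsCubeFace s ∧ D = f '' s

theorem exists_isChart {C : Set α} (hC : C ∈ X.cubes) :
    ∃ (n : ℕ) (f : (Fin n → Bool) → α), X.IsChart C f := by
  obtain ⟨n, f, h1, h2, h3⟩ := X.exists_chart C hC
  exact ⟨n, f, h1, h2, h3⟩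

namespace IsChart

variable {C : Set α} {n : ℕ} {f : (Fin n → Bool) → α}

theorem mem (hf : X.IsChart C f) (x : Fin n → Bool) : f x ∈ C := hf.range_eq ▸ ⟨x, rfl⟩

theorem adj_flip (hf : X.IsChart C f) (x : Fin n → Bool) (i : Fin n) :
    X.graph.Adj (f x) (f (flip i x)) := by
  refine adj_iff.2 ⟨fun h => flip_ne i x (hf.inj h).symm, ?_⟩
  rw [hf.mem_cubes_iff]
  · refine ⟨{x, flip i x}, ⟨{i}ᶜ, x, ?_⟩, by simp [Set.image_pair]⟩
    ext z
    simp only [Set.mem_insert_iff, Set.mem_singleton_iff, Set.mem_compl_iff, Set.mem_ofPred_eq]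
    constructor
    · rintro (rfl | rfl) j hj
      · rfl
      · exact flip_of_ne hj x
    · intro h
      by_cases hz : z i = x i
      · left; ext j
        by_cases hj : j = i
        · subst hj; rw [hz]
        · rw [h j hj]
      · right; ext j
        by_cases hj : j = i
        · subst hj; rw [flip_same]; cases h1 : z j <;> cases h2 : x j <;> simp_all
        · rw [h j hj, flip_of_ne hj]
  · rintro z (rfl | rfl) <;> exact hf.mem _

theorem exists_flip (hf : X.IsChart C f) {x y : Fin n → Bool} (h : X.graph.Adj (f x) (f y)) :
    ∃ i, y = flip i x := by
  obtain ⟨hne, hm⟩ := adj_iff.1 h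
  have hxy : x ≠ y := fun h => hne (h ▸ rfl)
  obtain ⟨s, ⟨J, a, hs⟩, he⟩ := (hf.mem_cubes_iff _ (by
    rintro z (rfl | rfl) <;> exact hf.mem _)).1 hm
  rw [← Set.image_pair] at he
  have he := hf.inj.image_injective he
  obtain ⟨i, hi⟩ := Function.ne_iff.1 hxy
  have hx : x ∈ s := he ▸ by simp
  have hy : y ∈ s := he ▸ by simp
  rw [hs] at hx hy
  have hiJ : i ∉ J := fun hJ => hi ((hx i hJ).trans (hy i hJ).symm)
  have hz : flip i x ∈ s := by
    rw [hs]
    intro j hj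
    rw [flip_of_ne (by rintro rfl; exact hiJ hj), hx j hj]
  rw [← he] at hz
  rcases hz with hz | hz
  · exact absurd hz (flip_ne i x)
  · exact ⟨i, hz.symm⟩

theorem square_flip (hf : X.IsChart C f) (x : Fin n → Bool) {i j : Fin n} (hij : i ≠ j) :
    X.Square (f x) (f (flip i x)) (f (flip j (flip i x))) (f (flip j x)) := by
  have e := flip_comm i j x
  refine ⟨?_, hf.adj_flip _ _, hf.adj_flip _ _, ?_, (hf.adj_flip _ _).symm, ?_, ?_⟩
  · rw [hf.mem_cubes_iff]
    · refine ⟨{x, flip i x, flip j (flip i x), flip j x}, ⟨{i, j}ᶜ, x, ?_⟩, by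
        simp [Set.image_insert_eq]⟩
      ext z
      simp only [Set.mem_insert_iff, Set.mem_singleton_iff, Set.mem_compl_iff, Set.mem_ofPred_eq,
        not_or]
      constructor
      · rintro (rfl | rfl | rfl | rfl) k ⟨h1, h2⟩ <;> simp [flip_of_ne, h1, h2]
      · intro h
        have key : ∀ w : Fin n → Bool, w i = z i → w j = z j →
            (∀ k, k ≠ i → k ≠ j → w k = x k) → z = w := by
          intro w h1 h2 h3
          ext k
          by_cases hi : k = i
          · subst hi; rw [h1]
          · by_cases hj : k = j
            · subst hj; rw [h2]
            · rw [h3 k hi hj, h k ⟨hi, hj⟩]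
        by_cases hi : z i = x i <;> by_cases hj : z j = x j
        · left; exact key x hi.symm hj.symm fun _ _ _ => rfl
        · right; right; right
          refine key _ ?_ ?_ fun k h1 h2 => flip_of_ne h2 x
          · rw [flip_of_ne hij, hi]
          · rw [flip_same]; cases h1 : z j <;> cases h2 : x j <;> simp_all
        · right; left
          refine key _ ?_ ?_ fun k h1 h2 => flip_of_ne h1 x
          · rw [flip_same]; cases h1 : z i <;> cases h2 : x i <;> simp_all
          · rw [flip_of_ne hij.symm, hj]
        · right; right; left
          refine key _ ?_ ?_ fun k h1 h2 => by rw [flip_of_ne h2, flip_of_ne h1]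
          · rw [flip_of_ne hij, flip_same]
            cases h1 : z i <;> cases h2 : x i <;> simp_all
          · rw [flip_same, flip_of_ne hij.symm]
            cases h1 : z j <;> cases h2 : x j <;> simp_all
    · rintro z (rfl | rfl | rfl | rfl) <;> exact hf.mem _
  · rw [← e]; exact (hf.adj_flip _ _).symm
  · intro h
    have := congrFun (hf.inj h) i
    simp [flip_same, flip_of_ne hij] at this
  · intro h
    have := congrFun (hf.inj h) i
    simp [flip_same, flip_of_ne hij] at this

end IsChart

/-! ### Consequences of simple connectivity and flagness near a vertex -/

theorem PathHomotopic.length_mod_two {u v : α} {p q : X.graph.Walk u v}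
    (h : X.PathHomotopic p q) : p.length % 2 = q.length % 2 := by
  induction h with
  | refl => rfl
  | symm _ ih => exact ih.symm
  | trans _ _ ih1 ih2 => exact ih1.trans ih2
  | cons _ _ ih => simp only [SimpleGraph.Walk.length_cons]; omega
  | backtrack => simp only [SimpleGraph.Walk.length_cons]; omega
  | square => simp only [SimpleGraph.Walk.length_cons]

theorem IsCAT0.not_triangle (hX : X.IsCAT0) (hab : X.graph.Adj a b) (hbc : X.graph.Adj b c) :
    ¬ X.graph.Adj a c := fun hac => by
  have := (hX.simplyConnected.2 a (.cons hab (.cons hbc (.cons hac.symm .nil)))).length_mod_two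
  simp at this

theorem IsCAT0.pair_mem_link (hX : X.IsCAT0) (h : X.Square a b c d) : {b, d} ∈ X.link a := by
  refine ⟨_, h.1, by simp, ?_⟩
  have h1 := hX.not_triangle h.2.1 h.2.2.1
  ext z
  simp only [Set.mem_insert_iff, Set.mem_singleton_iff, Set.mem_ofPred_eq]
  constructor
  · rintro (rfl | rfl)
    · simp [h.2.1]
    · simp [h.2.2.2.2.1.symm]
  · rintro ⟨rfl | rfl | rfl | rfl, hz⟩
    · exact absurd rfl hz.ne
    · simp
    · exact absurd hz h1
    · simp

theorem singleton_mem_link (h : X.graph.Adj a b) : {b} ∈ X.link a := by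
  refine ⟨_, (adj_iff.1 h).2, by simp, ?_⟩
  ext z
  simp only [Set.mem_insert_iff, Set.mem_singleton_iff, Set.mem_ofPred_eq]
  constructor
  · rintro rfl; simp [h]
  · rintro ⟨rfl | rfl, hz⟩
    · exact absurd rfl hz.ne
    · rfl

/-- The cube condition: three squares that meet pairwise in the three edges from `b` to `v`, `c`
and `e` are faces of a `3`-cube, whose vertex opposite to `b` is `g`. -/
theorem IsCAT0.exists_cube (hX : X.IsCAT0) {v e f : α} (h1 : X.Square b v a c)
    (h2 : X.Square b v d e) (h3 : X.Square b c f e) :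
    ∃ g, X.Square v a g d ∧ X.Square c a g f ∧ X.Square e d g f := by
  have hvc : v ≠ c := h1.2.2.2.2.2.2
  have hve : v ≠ e := h2.2.2.2.2.2.2
  have hce : c ≠ e := h3.2.2.2.2.2.2
  obtain ⟨D, hD, hbD, he⟩ := hX.flagLinks b {v, c, e} (Set.toFinite _) (by
    have e1 := hX.pair_mem_link h1
    have e2 := hX.pair_mem_link h2
    have e3 := hX.pair_mem_link h3
    have f1 := singleton_mem_link h1.2.1
    have f2 := singleton_mem_link h3.2.1
    have f3 := singleton_mem_link h3.2.2.2.2.1.symm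
    rintro s (rfl | rfl | rfl) t (rfl | rfl | rfl) <;>
      first | simpa using f1 | simpa using f2 | simpa using f3 | assumption |
        (rw [Set.pair_comm]; assumption))
  obtain ⟨n, φ, hφ⟩ := exists_isChart hD
  have aux : ∀ w ∈ ({v, c, e} : Set α), X.graph.Adj b w ∧ w ∈ Set.range φ := by
    intro w hw
    rw [he] at hw
    exact ⟨hw.2, hφ.range_eq ▸ hw.1⟩
  obtain ⟨hv, ⟨v, rfl⟩⟩ := aux v (by simp)
  obtain ⟨hc, ⟨c, rfl⟩⟩ := aux c (by simp)
  obtain ⟨he', ⟨e, rfl⟩⟩ := aux e (by simp)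
  rw [← hφ.range_eq] at hbD
  obtain ⟨b, rfl⟩ := hbD
  obtain ⟨i, rfl⟩ := hφ.exists_flip hv
  obtain ⟨j, rfl⟩ := hφ.exists_flip hc
  obtain ⟨k, rfl⟩ := hφ.exists_flip he'
  have hij : i ≠ j := fun h => hvc (h ▸ rfl)
  have hik : i ≠ k := fun h => hve (h ▸ rfl)
  have hjk : j ≠ k := fun h => hce (h ▸ rfl)
  have opp : ∀ {p q r s t : α}, X.Square p q r s → X.Square p q t s → r = t :=
    fun h h' => h.rotate.rotate.rotate.unique h'.rotate.rotate.rotate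
  obtain rfl := opp h1 (hφ.square_flip b hij)
  obtain rfl := opp h2 (hφ.square_flip b hik)
  obtain rfl := opp h3 (hφ.square_flip b hjk)
  refine ⟨φ (flip k (flip j (flip i b))), hφ.square_flip _ hjk, ?_, ?_⟩
  · have := hφ.square_flip (flip j b) hik
    rwa [flip_comm i j] at this
  · have := hφ.square_flip (flip k b) hij
    rwa [flip_comm i k, flip_comm j k, flip_comm j k] at this

/-! ### Normal forms of edge paths -/

/-- Equivalence of edge paths under pushing across squares only. A path is recorded by the list of
its vertices, last vertex first. -/
inductive SquareEquiv (X : CubeComplex α) : List α → List α → Prop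
  | refl (p : List α) : SquareEquiv X p p
  | symm {p q : List α} : SquareEquiv X p q → SquareEquiv X q p
  | trans {p q r : List α} : SquareEquiv X p q → SquareEquiv X q r → SquareEquiv X p r
  | cons (v : α) {p q : List α} : SquareEquiv X p q → SquareEquiv X (v :: p) (v :: q)
  | square {v a c b : α} (r : List α) :
      X.Square v a c b → SquareEquiv X (v :: a :: c :: r) (v :: b :: c :: r)

theorem SquareEquiv.length_eq {p q : List α} (h : X.SquareEquiv p q) : p.length = q.length := by
  induction h with
  | refl => rfl
  | symm _ ih => exact ih.symm
  | trans _ _ ih1 ih2 => exact ih1.trans ih2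
  | cons _ _ ih => simpa using ih
  | square => rfl

/-- The relation between two equivalent paths to `v`, in terms of the paths `q`, `q'` obtained by
deleting their last edges: `q` and `q'` are equivalent, or the last edges span a square and up to
equivalence both paths enter this square at the vertex opposite to `v`. -/
def LastStep (X : CubeComplex α) (v : α) (q q' : List α) : Prop :=
  X.SquareEquiv q q' ∨ ∃ (a b c : α) (r : List α), X.Square v a c b ∧
    X.SquareEquiv q (a :: c :: r) ∧ X.SquareEquiv q' (b :: c :: r)

theorem LastStep.symm {v : α} {q q' : List α} (h : X.LastStep v q q') : X.LastStep v q' q := by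
  rcases h with h | ⟨a, b, c, r, hs, h1, h2⟩
  · exact .inl h.symm
  · exact .inr ⟨b, a, c, r, hs.reflect, h2, h1⟩

theorem LastStep.squareEquiv {v : α} {q q' : List α} (h : X.LastStep v q q') :
    X.SquareEquiv (v :: q) (v :: q') := by
  rcases h with h | ⟨a, b, c, r, hs, h1, h2⟩
  · exact h.cons v
  · exact (h1.cons v).trans ((SquareEquiv.square r hs).trans (h2.cons v).symm)

theorem SquareEquiv.head_eq {p q : List α} (h : X.SquareEquiv p q) : p.head? = q.head? := by
  induction h with
  | refl => rfl
  | symm _ ih => exact ih.symm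
  | trans _ _ ih1 ih2 => exact ih1.trans ih2
  | cons => rfl
  | square => rfl

theorem SquareEquiv.eq_of_cons {x y : α} {p q : List α} (h : X.SquareEquiv (x :: p) (y :: q)) :
    x = y := by simpa using h.head_eq

/-- Two squares at the end of the path `q'` meet in their last edge. Either they have one more edge in
common and coincide, or, by the induction hypothesis `ih`, a third square makes the cube condition
applicable. -/
theorem LastStep.trans (hX : X.IsCAT0) {v : α} {q q' q'' : List α} (h : X.LastStep v q q')
    (h' : X.LastStep v q' q'')
    (ih : ∀ (x : α) (p p' : List α), (x :: p).length = q'.length →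
      X.SquareEquiv (x :: p) (x :: p') → X.LastStep x p p') :
    X.LastStep v q q'' := by
  rcases h with h | ⟨a, b, c, r, hs, h1, h2⟩
  · rcases h' with h' | ⟨a, b, c, r, hs, h1, h2⟩
    · exact .inl (h.trans h')
    · exact .inr ⟨a, b, c, r, hs, h.trans h1, h2⟩
  rcases h' with h' | ⟨b', d, e, s, hs', h1', h2'⟩
  · exact .inr ⟨a, b, c, r, hs, h1, h'.symm.trans h2⟩
  have h3 := h2.symm.trans h1'
  obtain rfl := h3.eq_of_cons
  rcases ih b (c :: r) (e :: s) h2.length_eq.symm h3 with h4 | ⟨c', e', f, t, hs'', h4, h5⟩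
  · obtain rfl := h4.eq_of_cons
    obtain rfl := hs.reflect.unique hs'
    exact .inl (h1.trans ((h4.cons a).trans h2'.symm))
  · obtain rfl := h4.eq_of_cons
    obtain rfl := h5.eq_of_cons
    -- the squares at `b` towards `v`, `c` and `e` span a `3`-cube, with vertex `g` opposite to `b`
    obtain ⟨g, k1, k2, k3⟩ :=
      hX.exists_cube hs.rotate.rotate.rotate hs'.reflect.rotate.rotate.rotate hs''
    exact .inr ⟨a, d, g, f :: t, k1,
      h1.trans ((h4.cons a).trans (.square t k2.reflect.rotate.rotate.rotate)),
      h2'.trans ((h5.cons d).trans (.square t k3.reflect.rotate.rotate.rotate))⟩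

/-- Induction on the length makes `LastStep` transitive, so that it contains the whole equivalence
relation. -/
theorem SquareEquiv.eq_or_lastStep (hX : X.IsCAT0) (n : ℕ) : ∀ p p' : List α, p.length = n →
    X.SquareEquiv p p' →
      p = p' ∨ ∃ v q q', p = v :: q ∧ p' = v :: q' ∧ X.LastStep v q q' := by
  induction n using Nat.strong_induction_on with
  | _ n ih =>
    intro p p' hn h
    induction h with
    | refl => exact .inl rfl
    | symm h' ih' =>
      rcases ih' (h'.length_eq.trans hn) with h | ⟨v, q, q', h1, h2, h3⟩
      · exact .inl h.symm
      · exact .inr ⟨v, q', q, h2, h1, h3.symm⟩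
    | trans h1 h2 ih1 ih2 =>
      rcases ih1 hn with rfl | ⟨v, q, q', rfl, rfl, h3⟩
      · exact ih2 hn
      rcases ih2 (h1.length_eq.symm.trans hn) with rfl | ⟨v', q₂, q₃, he, rfl, h4⟩
      · exact .inr ⟨v, q, q', rfl, rfl, h3⟩
      · obtain ⟨rfl, rfl⟩ := List.cons.inj he
        refine .inr ⟨_, _, _, rfl, rfl, h3.trans hX h4 fun x r r' hl hr => ?_⟩
        have hl' := h1.length_eq
        simp only [List.length_cons] at hl hl' hn
        rcases ih _ (by rw [List.length_cons]; omega) _ _ rfl hr with h | ⟨v, _, _, h5, h6, h7⟩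
        · exact .inl ((List.cons.inj h).2 ▸ .refl _)
        · obtain ⟨rfl, rfl⟩ := List.cons.inj h5
          obtain ⟨-, rfl⟩ := List.cons.inj h6
          exact h7
    | cons v h => exact .inr ⟨v, _, _, rfl, rfl, .inl h⟩
    | square r hs => exact .inr ⟨_, _, _, rfl, rfl, .inr ⟨_, _, _, r, hs, .refl _, .refl _⟩⟩

/-- Equivalence of paths is generated at the last step. -/
theorem SquareEquiv.lastStep (hX : X.IsCAT0) {v : α} {q q' : List α}
    (h : X.SquareEquiv (v :: q) (v :: q')) : X.LastStep v q q' := by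
  rcases h.eq_or_lastStep hX _ _ _ rfl with h | ⟨_, _, _, h5, h6, h7⟩
  · exact .inl ((List.cons.inj h).2 ▸ .refl _)
  · obtain ⟨rfl, rfl⟩ := List.cons.inj h5
    obtain ⟨-, rfl⟩ := List.cons.inj h6
    exact h7

/-- `w` is a descent of the path `p` to `v` if, up to equivalence, the last edge of `p` runs from
`w` to `v`. -/
def Descent (X : CubeComplex α) (p : List α) (w : α) : Prop :=
  ∃ v q, X.SquareEquiv p (v :: w :: q)

theorem Descent.congr {p q : List α} {w : α} (h : X.SquareEquiv p q) (hd : X.Descent p w) :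
    X.Descent q w := by
  obtain ⟨v, r, hr⟩ := hd
  exact ⟨v, r, h.symm.trans hr⟩

theorem SquareEquiv.tail (hX : X.IsCAT0) {v v' w : α} {q q' : List α}
    (h : X.SquareEquiv (v :: w :: q) (v' :: w :: q')) : X.SquareEquiv (w :: q) (w :: q') := by
  obtain rfl := h.eq_of_cons
  rcases h.lastStep hX with h | ⟨a, b, c, r, hs, h1, h2⟩
  · exact h
  · exact absurd (h1.eq_of_cons.symm.trans h2.eq_of_cons) hs.2.2.2.2.2.2

/-- Two different descents span a square, and both are reached through its fourth vertex. -/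
theorem SquareEquiv.exists_square (hX : X.IsCAT0) {v a b : α} {q q' : List α}
    (h : X.SquareEquiv (v :: a :: q) (v :: b :: q')) (hab : a ≠ b) :
    ∃ c r, X.Square v a c b ∧ X.SquareEquiv (a :: q) (a :: c :: r) ∧
      X.SquareEquiv (b :: q') (b :: c :: r) := by
  rcases h.lastStep hX with h | ⟨a', b', c, r, hs, h1, h2⟩
  · exact absurd h.eq_of_cons hab
  · obtain rfl := h1.eq_of_cons
    obtain rfl := h2.eq_of_cons
    exact ⟨c, r, hs, h1, h2⟩

/-- A path is reduced if no edge of it can be cancelled with an earlier one, even after pushing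
the path across squares. -/
def Reduced (X : CubeComplex α) : List α → Prop
  | [] => True
  | w :: p => Reduced X p ∧ ¬ X.Descent p w

/-- The definition of a reduced path refers to its initial segments only; the point here is that it
is nevertheless invariant under pushing the last two edges across a square. -/
theorem Reduced.congr (hX : X.IsCAT0) (n : ℕ) : ∀ p p' : List α, p.length = n →
    X.SquareEquiv p p' → X.Reduced p → X.Reduced p' := by
  induction n using Nat.strong_induction_on with
  | _ n ih =>
    intro p p' hn h hp
    rcases h.eq_or_lastStep hX _ _ _ rfl with rfl | ⟨w, q, q', rfl, rfl, h'⟩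
    · exact hp
    have hlen := h'.squareEquiv.length_eq
    simp only [List.length_cons] at hn hlen
    rcases h' with h | ⟨v, v', c, r, hs, h1, h2⟩
    · exact ⟨ih _ (by omega) _ _ rfl h hp.1, fun hd => hp.2 (hd.congr h.symm)⟩
    have hl1 := h1.length_eq
    have hl2 := h2.length_eq
    simp only [List.length_cons] at hl1 hl2
    have hr := ih _ (by omega) _ _ rfl h1 hp.1
    have hv : ¬ X.Descent (c :: r) v' := by
      rintro ⟨c', s, hs'⟩
      obtain rfl := hs'.eq_of_cons
      exact hp.2 ⟨v, v' :: s, h1.trans ((hs'.cons v).trans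
        (.square s hs.rotate))⟩
    have hw : ¬ X.Descent (v' :: c :: r) w := by
      rintro ⟨v'', s, hs'⟩
      obtain rfl := hs'.eq_of_cons
      obtain ⟨f, t, k1, k2, k3⟩ := hs'.exists_square hX hs.2.2.2.2.2.1.symm
      obtain rfl := hs.rotate.rotate.unique k1.reflect.rotate.rotate.rotate
      exact hr.2 ⟨c, t, k2⟩
    exact ⟨ih _ (by simp; omega) _ _ rfl h2.symm ⟨hr.1, hv⟩, fun hd => hw (hd.congr h2)⟩

open Classical in
/-- The action of the edge from the end of `p` to `w` on the path `p`: the edge is cancelled if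
possible, and appended otherwise. -/
noncomputable def extend (X : CubeComplex α) (p : List α) (w : α) : List α :=
  if h : X.Descent p w then w :: h.choose_spec.choose else w :: p

theorem extend_of_not_descent {p : List α} {w : α} (h : ¬ X.Descent p w) :
    X.extend p w = w :: p := dif_neg h

/-- Although cancelling involves a choice, its result is determined up to equivalence. -/
theorem extend_of_squareEquiv (hX : X.IsCAT0) {p q : List α} {v w : α}
    (h : X.SquareEquiv p (v :: w :: q)) : X.SquareEquiv (X.extend p w) (w :: q) := by
  have hd : X.Descent p w := ⟨v, q, h⟩
  rw [extend, dif_pos hd]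
  exact (hd.choose_spec.choose_spec.symm.trans h).tail hX

theorem extend_congr (hX : X.IsCAT0) {p q : List α} (h : X.SquareEquiv p q) (w : α) :
    X.SquareEquiv (X.extend p w) (X.extend q w) := by
  by_cases hd : X.Descent q w
  · obtain ⟨v, r, hr⟩ := hd
    exact (extend_of_squareEquiv hX (h.trans hr)).trans (extend_of_squareEquiv hX hr).symm
  · rw [extend_of_not_descent hd, extend_of_not_descent fun h' => hd (h'.congr h)]
    exact h.cons w

theorem Reduced.extend (hX : X.IsCAT0) {p : List α} (hp : X.Reduced p) (w : α) :
    X.Reduced (X.extend p w) := by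
  by_cases hd : X.Descent p w
  · obtain ⟨v, r, hr⟩ := hd
    exact Reduced.congr hX _ _ _ rfl (extend_of_squareEquiv hX hr).symm
      (Reduced.congr hX _ _ _ rfl hr hp).1
  · rw [extend_of_not_descent hd]
    exact ⟨hp, hd⟩

theorem extend_backtrack (hX : X.IsCAT0) {u w : α} {p : List α} (hp : X.Reduced (u :: p)) :
    X.SquareEquiv (X.extend (X.extend (u :: p) w) u) (u :: p) := by
  by_cases hd : X.Descent (u :: p) w
  · obtain ⟨v, r, hr⟩ := hd
    obtain rfl := hr.eq_of_cons
    refine (extend_congr hX (extend_of_squareEquiv hX hr) u).trans ?_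
    rw [extend_of_not_descent (Reduced.congr hX _ _ _ rfl hr hp).2]
    exact hr.symm
  · rw [extend_of_not_descent hd]
    exact extend_of_squareEquiv hX (.refl _)

theorem extend_square_of_not_descent (hX : X.IsCAT0) {a b c d : α} {p : List α}
    (hs : X.Square a b c d) (hb : ¬ X.Descent (a :: p) b) (hd : ¬ X.Descent (a :: p) d) :
    X.extend (X.extend (a :: p) b) c = c :: b :: a :: p := by
  rw [extend_of_not_descent hb, extend_of_not_descent]
  rintro ⟨b', q, hq⟩
  obtain rfl := hq.eq_of_cons
  obtain ⟨f, r, h1, h2, -⟩ := hq.exists_square hX hs.2.2.2.2.2.1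
  obtain rfl := hs.reflect.rotate.rotate.unique h1.rotate.rotate.rotate
  exact hd ⟨a, r, h2⟩

theorem extend_square_of_descent_of_not (hX : X.IsCAT0) {a b c d : α} {p : List α}
    (hs : X.Square a b c d) (hb : X.Descent (a :: p) b) (hd : ¬ X.Descent (a :: p) d) :
    X.SquareEquiv (X.extend (X.extend (a :: p) b) c) (X.extend (X.extend (a :: p) d) c) := by
  obtain ⟨a', q, hq⟩ := hb
  obtain rfl := hq.eq_of_cons
  rw [extend_of_not_descent hd]
  have h1 : ¬ X.Descent (b :: q) c := by
    rintro ⟨b', r, hr⟩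
    obtain rfl := hr.eq_of_cons
    exact hd ⟨a, c :: r, hq.trans ((hr.cons a).trans (.square r hs))⟩
  refine (extend_congr hX (extend_of_squareEquiv hX hq) c).trans ?_
  rw [extend_of_not_descent h1]
  exact (extend_of_squareEquiv hX ((hq.cons d).trans
    (.square q hs.rotate.rotate.rotate))).symm

theorem extend_square (hX : X.IsCAT0) {a b c d : α} {p : List α} (hs : X.Square a b c d) :
    X.SquareEquiv (X.extend (X.extend (a :: p) b) c) (X.extend (X.extend (a :: p) d) c) := by
  by_cases hb : X.Descent (a :: p) b <;> by_cases hd : X.Descent (a :: p) d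
  · obtain ⟨a', q, hq⟩ := hb
    obtain rfl := hq.eq_of_cons
    obtain ⟨a', q', hq'⟩ := hd
    obtain rfl := hq'.eq_of_cons
    obtain ⟨e, r, h1, h2, h3⟩ := (hq.symm.trans hq').exists_square hX hs.2.2.2.2.2.2
    obtain rfl := hs.rotate.rotate.rotate.unique h1.rotate.rotate.rotate
    exact ((extend_congr hX (extend_of_squareEquiv hX hq) c).trans
      (extend_of_squareEquiv hX h2)).trans
      ((extend_congr hX (extend_of_squareEquiv hX hq') c).trans
      (extend_of_squareEquiv hX h3)).symm
  · exact extend_square_of_descent_of_not hX hs hb hd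
  · exact (extend_square_of_descent_of_not hX hs.reflect hd hb).symm
  · rw [extend_square_of_not_descent hX hs hb hd,
      extend_square_of_not_descent hX hs.reflect hd hb]
    exact .square _ hs.rotate.rotate.reflect

theorem extend_eq_cons (p : List α) (w : α) : ∃ q, X.extend p w = w :: q := by
  by_cases hd : X.Descent p w
  · exact ⟨_, dif_pos hd⟩
  · exact ⟨_, dif_neg hd⟩

/-- The action of a walk on paths, edge by edge. -/
noncomputable def run (X : CubeComplex α) {u v : α} : X.graph.Walk u v → List α → List α
  | .nil, p => p
  | .cons (v := w) _ q, p => X.run q (X.extend p w)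

theorem run_congr (hX : X.IsCAT0) {u v : α} (q : X.graph.Walk u v) :
    ∀ {p p' : List α}, X.SquareEquiv p p' → X.SquareEquiv (X.run q p) (X.run q p') := by
  induction q with
  | nil => exact fun h => h
  | cons _ q ih => exact fun h => ih (extend_congr hX h _)

theorem Reduced.run (hX : X.IsCAT0) {u v : α} (q : X.graph.Walk u v) :
    ∀ {p : List α}, X.Reduced p → X.Reduced (X.run q p) := by
  induction q with
  | nil => exact fun h => h
  | cons _ q ih => exact fun h => ih (h.extend hX _)

theorem run_append {u v w : α} (q : X.graph.Walk u v) (r : X.graph.Walk v w) :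
    ∀ p : List α, X.run (q.append r) p = X.run r (X.run q p) := by
  induction q with
  | nil => exact fun p => rfl
  | cons _ q ih => exact fun p => ih r _

theorem run_eq_cons {u v : α} (q : X.graph.Walk u v) :
    ∀ p : List α, ∃ p', X.run q (u :: p) = v :: p' := by
  induction q with
  | nil => exact fun p => ⟨p, rfl⟩
  | @cons u w v _ q ih =>
    intro p
    obtain ⟨r, hr⟩ := extend_eq_cons (X := X) (u :: p) w
    obtain ⟨s, hs⟩ := ih r
    exact ⟨s, by rw [run, hr, hs]⟩

theorem PathHomotopic.run (hX : X.IsCAT0) {u v : α} {q q' : X.graph.Walk u v}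
    (h : X.PathHomotopic q q') : ∀ p : List α, X.Reduced (u :: p) →
      X.SquareEquiv (X.run q (u :: p)) (X.run q' (u :: p)) := by
  induction h with
  | refl => exact fun _ _ => .refl _
  | symm _ ih => exact fun p hp => (ih p hp).symm
  | trans _ _ ih1 ih2 => exact fun p hp => (ih1 p hp).trans (ih2 p hp)
  | @cons u v w h q q' _ ih =>
    intro p hp
    have hp' := hp.extend hX v
    simp only [CubeComplex.run]
    obtain ⟨r, hr⟩ := extend_eq_cons (X := X) (u :: p) v
    rw [hr] at hp' ⊢
    exact ih r hp'
  | backtrack h q => exact fun p hp => run_congr hX q (extend_backtrack hX hp)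
  | square _ _ _ _ q hs => exact fun p hp => run_congr hX q (extend_square hX hs)

/-- By simple connectivity, walks with the same end points act in the same way. -/
theorem run_equiv (hX : X.IsCAT0) {u v : α} (q q' : X.graph.Walk u v) {p : List α}
    (hp : X.Reduced (u :: p)) : X.SquareEquiv (X.run q (u :: p)) (X.run q' (u :: p)) := by
  have h1 := (hX.simplyConnected.2 u (q.append q.reverse)).run hX p hp
  have h2 := hp.run hX q
  obtain ⟨r, hr⟩ := run_eq_cons q p
  rw [hr] at h2
  have h3 := (hX.simplyConnected.2 v (q.reverse.append q')).run hX r h2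
  rw [run_append] at h1 h3
  rw [hr] at h1 ⊢
  exact h3.symm.trans (run_congr hX q' h1)

theorem connected (hX : X.IsCAT0) : X.graph.Connected := hX.simplyConnected.1

/-- A reduced path from `o` to `v`. -/
noncomputable def normalForm (hX : X.IsCAT0) (o v : α) : List α :=
  X.run ((connected hX).preconnected o v).some [o]

theorem reduced_singleton (o : α) : X.Reduced [o] := by
  refine ⟨trivial, ?_⟩
  rintro ⟨v, q, h⟩
  simpa using h.length_eq

theorem run_normalForm (hX : X.IsCAT0) (o : α) {v w : α} (q : X.graph.Walk v w) :
    X.SquareEquiv (X.run q (X.normalForm hX o v)) (X.normalForm hX o w) := by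
  rw [normalForm, ← run_append]
  exact run_equiv hX _ _ (reduced_singleton o)

theorem normalForm_eq_cons (hX : X.IsCAT0) (o v : α) : ∃ p, X.normalForm hX o v = v :: p :=
  run_eq_cons _ _

theorem extend_normalForm (hX : X.IsCAT0) (o : α) {v w : α} (h : X.graph.Adj v w) :
    X.SquareEquiv (X.extend (X.normalForm hX o v) w) (X.normalForm hX o w) :=
  run_normalForm hX o (.cons h .nil)

/-- `p` lists the vertices of an edge path that starts at `o`. -/
def IsPathFrom (X : CubeComplex α) (o : α) (p : List α) : Prop :=
  p.IsChain X.graph.Adj ∧ p.getLast? = some o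

theorem SquareEquiv.isPathFrom_iff {o : α} {p q : List α} (h : X.SquareEquiv p q) :
    X.IsPathFrom o p ↔ X.IsPathFrom o q := by
  induction h with
  | refl => rfl
  | symm _ ih => exact ih.symm
  | trans _ _ ih1 ih2 => exact ih1.trans ih2
  | @cons v p q h ih =>
    have := h.head_eq
    cases p <;> cases q <;> simp_all [IsPathFrom, List.isChain_cons_cons]
    tauto
  | square r hs =>
    obtain ⟨-, h1, h2, h3, h4, -⟩ := hs
    simp [IsPathFrom, List.isChain_cons_cons, List.getLast?_cons_cons, h1, h2, h4.symm, h3.symm]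

theorem IsPathFrom.extend (hX : X.IsCAT0) {o v w : α} {p : List α} (h : X.graph.Adj v w)
    (hp : X.IsPathFrom o (v :: p)) : X.IsPathFrom o (X.extend (v :: p) w) := by
  by_cases hd : X.Descent (v :: p) w
  · obtain ⟨v, r, hr⟩ := hd
    rw [(extend_of_squareEquiv hX hr).isPathFrom_iff]
    have := hr.isPathFrom_iff.1 hp
    simp_all [IsPathFrom, List.isChain_cons_cons, List.getLast?_cons_cons]
  · rw [extend_of_not_descent hd]
    simp_all [IsPathFrom, List.isChain_cons_cons, List.getLast?_cons_cons, h.symm]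

theorem IsPathFrom.run (hX : X.IsCAT0) {o u v : α} (q : X.graph.Walk u v) :
    ∀ {p : List α}, X.IsPathFrom o (u :: p) → X.IsPathFrom o (X.run q (u :: p)) := by
  induction q with
  | nil => exact fun h => h
  | @cons u w v hu q ih =>
    intro p hp
    have hp' := hp.extend hX hu
    simp only [CubeComplex.run]
    obtain ⟨r, hr⟩ := extend_eq_cons (X := X) (u :: p) w
    rw [hr] at hp' ⊢
    exact ih hp'

theorem IsPathFrom.dist_lt (hX : X.IsCAT0) {o : α} : ∀ (p : List α) {v : α},
    X.IsPathFrom o (v :: p) → X.graph.dist o v < (v :: p).length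
  | [], v, h => by simp [IsPathFrom] at h; simp [h.symm]
  | w :: p, v, h => by
    simp only [IsPathFrom, List.isChain_cons_cons, List.getLast?_cons_cons] at h
    have h1 := IsPathFrom.dist_lt hX p (v := w) ⟨h.1.2, h.2⟩
    have h2 := (connected hX).dist_triangle (u := o) (v := w) (w := v)
    have h3 : X.graph.dist w v = 1 := SimpleGraph.dist_eq_one_iff_adj.2 h.1.1.symm
    simp only [List.length_cons] at h1 ⊢
    omega

theorem length_extend (hX : X.IsCAT0) (p : List α) (w : α) :
    (X.Descent p w ∧ (X.extend p w).length + 1 = p.length) ∨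
      (¬ X.Descent p w ∧ (X.extend p w).length = p.length + 1) := by
  by_cases hd : X.Descent p w
  · left
    refine ⟨hd, ?_⟩
    obtain ⟨v, r, hr⟩ := hd
    rw [(extend_of_squareEquiv hX hr).length_eq, hr.length_eq]
    simp
  · right
    rw [extend_of_not_descent hd]
    exact ⟨hd, rfl⟩

theorem length_run_le (hX : X.IsCAT0) {u v : α} (q : X.graph.Walk u v) :
    ∀ p : List α, (X.run q p).length ≤ p.length + q.length := by
  induction q with
  | nil => exact fun p => le_rfl
  | @cons u w v hu q ih =>
    intro p
    have := ih (X.extend p w)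
    have h := length_extend hX p w
    simp only [run, SimpleGraph.Walk.length_cons]
    omega

/-- The normal form has one vertex more than a geodesic has edges. -/
theorem length_normalForm (hX : X.IsCAT0) (o v : α) :
    (X.normalForm hX o v).length = X.graph.dist o v + 1 := by
  apply le_antisymm
  · obtain ⟨q, hq⟩ := (connected hX).exists_walk_length_eq_dist o v
    have h := run_equiv hX q ((connected hX).preconnected o v).some (reduced_singleton o)
    rw [normalForm, ← h.length_eq, ← hq]
    have := length_run_le hX q [o]
    simp only [List.length_singleton] at this
    omega
  · have h : X.IsPathFrom o (X.normalForm hX o v) :=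
      IsPathFrom.run hX _ (by simp [IsPathFrom])
    obtain ⟨p, hp⟩ := normalForm_eq_cons hX o v
    rw [hp] at h ⊢
    exact h.dist_lt hX

/-- A neighbour `w` of `v` is closer to `o` than `v` precisely if it is a descent of the normal form
of `v`; the distances never agree. -/
theorem dist_adj (hX : X.IsCAT0) (o : α) {v w : α} (h : X.graph.Adj v w) :
    (X.Descent (X.normalForm hX o v) w ∧ X.graph.dist o w + 1 = X.graph.dist o v) ∨
      (¬ X.Descent (X.normalForm hX o v) w ∧ X.graph.dist o w = X.graph.dist o v + 1) := by
  have h1 := length_extend hX (X.normalForm hX o v) w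
  rw [(extend_normalForm hX o h).length_eq, length_normalForm, length_normalForm] at h1
  simpa using h1

/-- The quadrangle condition: two neighbours of `v` that are closer to `o` than `v` span with `v`
a square, whose fourth vertex is still closer to `o`. -/
theorem IsCAT0.quadrangle (hX : X.IsCAT0) {o v a b : α} (ha : X.graph.Adj v a)
    (hb : X.graph.Adj v b) (hab : a ≠ b) (ha' : X.graph.dist o a < X.graph.dist o v)
    (hb' : X.graph.dist o b < X.graph.dist o v) :
    ∃ c, X.Square v a c b ∧ X.graph.dist o c + 1 = X.graph.dist o a ∧
      X.graph.dist o c + 1 = X.graph.dist o b := by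
  have ha1 := dist_adj hX o ha
  have hb1 := dist_adj hX o hb
  obtain ⟨v', q, hq⟩ : X.Descent (X.normalForm hX o v) a := by
    rcases ha1 with h | h
    · exact h.1
    · omega
  obtain ⟨v'', q', hq'⟩ : X.Descent (X.normalForm hX o v) b := by
    rcases hb1 with h | h
    · exact h.1
    · omega
  have h := hq.symm.trans hq'
  obtain ⟨p, hp⟩ := normalForm_eq_cons hX o v
  rw [hp] at hq
  obtain rfl := hq.eq_of_cons
  obtain rfl := h.eq_of_cons
  obtain ⟨c, r, hs, h1, -⟩ := h.exists_square hX hab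
  have h2 : X.Descent (X.normalForm hX o a) c :=
    ⟨a, r, (extend_normalForm hX o ha).symm.trans
      ((extend_of_squareEquiv hX (hp ▸ hq)).trans h1)⟩
  refine ⟨c, hs, ?_⟩
  have h3 := dist_adj hX o hs.2.2.1
  rcases h3 with h3 | h3
  · omega
  · exact absurd h2 h3.1

theorem IsCAT0.dist_adj_cases (hX : X.IsCAT0) (o : α) {v w : α} (h : X.graph.Adj v w) :
    X.graph.dist o w + 1 = X.graph.dist o v ∨ X.graph.dist o w = X.graph.dist o v + 1 :=
  (dist_adj hX o h).imp And.right And.right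

/-! ### Halfspaces -/

theorem exists_adj_closer (hX : X.IsCAT0) {x y : α} (h : x ≠ y) :
    ∃ x', X.graph.Adj x x' ∧ X.graph.dist x' y + 1 = X.graph.dist x y := by
  obtain ⟨p, hp⟩ := (connected hX).exists_walk_length_eq_dist x y
  cases p with
  | nil => exact absurd rfl h
  | @cons _ x' _ hadj q =>
    refine ⟨x', hadj, ?_⟩
    have h1 := SimpleGraph.dist_le q
    have h2 := (connected hX).dist_triangle (u := x) (v := x') (w := y)
    have h3 : X.graph.dist x x' = 1 := SimpleGraph.dist_eq_one_iff_adj.2 hadj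
    rw [SimpleGraph.Walk.length_cons] at hp
    omega

theorem dist_eq_one (h : X.graph.Adj a b) : X.graph.dist a b = 1 :=
  SimpleGraph.dist_eq_one_iff_adj.2 h

/-- The set of vertices that are closer to `a` than to `b`. For an edge from `a` to `b` this is the
halfspace that contains `a` and is bounded by the hyperplane dual to the edge. -/
def side (X : CubeComplex α) (a b : α) : Set α :=
  {z | X.graph.dist z a < X.graph.dist z b}

theorem mem_side {z : α} : z ∈ X.side a b ↔ X.graph.dist z a < X.graph.dist z b := Iff.rfl

theorem left_mem_side (h : X.graph.Adj a b) : a ∈ X.side a b := by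
  rw [mem_side, SimpleGraph.dist_self, dist_eq_one h]; exact one_pos

theorem compl_side (hX : X.IsCAT0) (h : X.graph.Adj a b) : (X.side a b)ᶜ = X.side b a := by
  ext z
  rw [Set.mem_compl_iff, mem_side, mem_side]
  have := hX.dist_adj_cases z h
  omega

theorem right_notMem_side (hX : X.IsCAT0) (h : X.graph.Adj a b) : b ∉ X.side a b := by
  rw [← Set.mem_compl_iff, compl_side hX h]
  exact left_mem_side h.symm

theorem side_subset_of_square (hX : X.IsCAT0) (h : X.Square a b c d) :
    X.side a b ⊆ X.side d c := by
  intro z hz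
  rw [mem_side] at *
  have h1 := hX.dist_adj_cases z h.2.1
  have h2 := hX.dist_adj_cases z h.2.2.1
  have h3 := hX.dist_adj_cases z h.2.2.2.1
  have h4 := hX.dist_adj_cases z h.2.2.2.2.1
  by_contra hlt
  obtain ⟨f, hf, hf1, hf2⟩ := hX.quadrangle (o := z) h.2.1.symm h.2.2.1 h.2.2.2.2.2.1 hz (by omega)
  -- the square at `b` given by the quadrangle condition is the given one
  obtain rfl := hf.rotate.rotate.rotate.unique h.rotate.rotate.reflect
  omega

theorem side_eq_of_square (hX : X.IsCAT0) (h : X.Square a b c d) : X.side a b = X.side d c :=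
  (side_subset_of_square hX h).antisymm (side_subset_of_square hX h.reflect.rotate)

theorem OrientedParallel.side_eq (hX : X.IsCAT0) {e f : α × α} (h : X.OrientedParallel e f) :
    X.side e.1 e.2 = X.side f.1 f.2 := by
  induction h with
  | rel e f h => exact side_eq_of_square hX h
  | refl => rfl
  | symm _ _ _ ih => exact ih.symm
  | trans _ _ _ _ _ ih1 ih2 => exact ih1.trans ih2

theorem OrientedParallel.adj_iff {e f : α × α} (h : X.OrientedParallel e f) :
    X.graph.Adj e.1 e.2 ↔ X.graph.Adj f.1 f.2 := by
  induction h with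
  | rel e f h => exact iff_of_true h.2.1 h.2.2.2.1.symm
  | refl => rfl
  | symm _ _ _ ih => exact ih.symm
  | trans _ _ _ _ _ ih1 ih2 => exact ih1.trans ih2

/-- An edge that crosses from a halfspace to its complement is dual to the hyperplane that bounds
the halfspace. -/
theorem orientedParallel_of_mem (hX : X.IsCAT0) (hab : X.graph.Adj a b) (hcd : X.graph.Adj c d)
    (hc : c ∈ X.side a b) (hd : d ∉ X.side a b) : X.OrientedParallel (a, b) (c, d) := by
  induction hn : X.graph.dist c a using Nat.strong_induction_on generalizing c d with
  | _ n ih =>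
    have k1 := hX.dist_adj_cases c hab
    have k2 := hX.dist_adj_cases d hab
    have k3 := hX.dist_adj_cases a hcd
    have k4 := hX.dist_adj_cases b hcd
    rw [mem_side] at hc hd
    rw [SimpleGraph.dist_comm (u := a), SimpleGraph.dist_comm (u := a)] at k3
    rw [SimpleGraph.dist_comm (u := b), SimpleGraph.dist_comm (u := b)] at k4
    by_cases hca : c = a
    · subst hca
      rw [SimpleGraph.dist_self] at *
      have : d = b := ((connected hX).dist_eq_zero_iff).1 (by omega)
      subst this
      exact .refl _
    obtain ⟨c', hc', hc1⟩ := exists_adj_closer hX hca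
    have k5 := hX.dist_adj_cases c' hab
    have k6 := hX.dist_adj_cases b hc'
    rw [SimpleGraph.dist_comm (u := b), SimpleGraph.dist_comm (u := b)] at k6
    have hdc' : d ≠ c' := by rintro rfl; omega
    obtain ⟨d', hs, h1, h2⟩ := hX.quadrangle (o := b) hcd hc' hdc'
      (by simp only [SimpleGraph.dist_comm (u := b)]; omega)
      (by simp only [SimpleGraph.dist_comm (u := b)]; omega)
    simp only [SimpleGraph.dist_comm (u := b)] at h1 h2
    have k7 := hX.dist_adj_cases d' hab
    have k8 := hX.dist_adj_cases a hs.2.2.1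
    rw [SimpleGraph.dist_comm (u := a), SimpleGraph.dist_comm (u := a)] at k8
    have := ih (X.graph.dist c' a) (by omega) hs.2.2.2.1.symm
      (by rw [mem_side]; omega) (by rw [mem_side]; omega) rfl
    exact this.trans _ _ _ (.symm _ _ (.rel _ _ hs))

/-- A halfspace: one side of a hyperplane. -/
def IsHalfspace (X : CubeComplex α) (K : Set α) : Prop :=
  ∃ a b, X.graph.Adj a b ∧ K = X.side a b

theorem IsHalfspace.compl (hX : X.IsCAT0) {K : Set α} (hK : X.IsHalfspace K) :
    X.IsHalfspace Kᶜ := by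
  obtain ⟨a, b, h, rfl⟩ := hK
  exact ⟨b, a, h.symm, compl_side hX h⟩

theorem IsHalfspace.eq_side (hX : X.IsCAT0) {K : Set α} (hK : X.IsHalfspace K)
    (h : X.graph.Adj a b) (ha : a ∈ K) (hb : b ∉ K) : K = X.side a b := by
  obtain ⟨c, d, hcd, rfl⟩ := hK
  exact (orientedParallel_of_mem hX hcd h ha hb).side_eq hX

theorem exists_edge_between (hX : X.IsCAT0) {K : Set α} {p z : α} (hp : p ∈ K) (hz : z ∉ K) :
    ∃ c d, X.graph.Adj c d ∧ c ∈ K ∧ d ∉ K ∧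
      X.graph.dist p c + 1 + X.graph.dist d z = X.graph.dist p z := by
  induction hn : X.graph.dist p z generalizing p with
  | zero => exact absurd (((connected hX).dist_eq_zero_iff).1 hn ▸ hp) hz
  | succ n ih =>
    obtain ⟨p', h1, h2⟩ := exists_adj_closer hX (x := p) (y := z) (by rintro rfl; exact hz hp)
    by_cases hp' : p' ∈ K
    · obtain ⟨c, d, h3, h4, h5, h6⟩ := ih hp' (by omega)
      refine ⟨c, d, h3, h4, h5, ?_⟩
      have e1 := (connected hX).dist_triangle (u := p) (v := p') (w := c)
      have e2 := (connected hX).dist_triangle (u := p) (v := c) (w := z)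
      have e3 := (connected hX).dist_triangle (u := c) (v := d) (w := z)
      rw [dist_eq_one h1] at e1
      rw [dist_eq_one h3] at e3
      omega
    · refine ⟨p, p', h1, hp, hp', ?_⟩
      rw [SimpleGraph.dist_self]; omega

/-- Geodesic convexity; unlike for a convex subcomplex, nonemptiness is not required. -/
def IsConvex (X : CubeComplex α) (A : Set α) : Prop :=
  ∀ a ∈ A, ∀ b ∈ A, ∀ w : α, X.graph.dist a w + X.graph.dist w b = X.graph.dist a b → w ∈ A

theorem ConvexSubcomplex.isConvex {A : Set α} (h : X.ConvexSubcomplex A) : X.IsConvex A := h.2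

theorem IsConvex.inter {A B : Set α} (hA : X.IsConvex A) (hB : X.IsConvex B) :
    X.IsConvex (A ∩ B) :=
  fun a ha b hb w hw => ⟨hA a ha.1 b hb.1 w hw, hB a ha.2 b hb.2 w hw⟩

/-- A geodesic that left the halfspace and came back to it would cross two parallel edges in
opposite directions, and could be shortened. -/
theorem IsHalfspace.isConvex (hX : X.IsCAT0) {K : Set α} (hK : X.IsHalfspace K) :
    X.IsConvex K := by
  intro p hp q hq z hz
  by_contra hzK
  obtain ⟨c, d, h1, h2, h3, h4⟩ := exists_edge_between hX hp hzK
  obtain ⟨c', d', h1', h2', h3', h4'⟩ := exists_edge_between hX hq hzK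
  rw [hK.eq_side hX h1 h2 h3, mem_side] at h2'
  have e1 := (connected hX).dist_triangle (u := p) (v := c) (w := q)
  have e2 := (connected hX).dist_triangle (u := c) (v := c') (w := q)
  have e3 := (connected hX).dist_triangle (u := c') (v := d') (w := d)
  have e4 := (connected hX).dist_triangle (u := d') (v := z) (w := d)
  rw [dist_eq_one h1'] at e3
  rw [SimpleGraph.dist_comm (u := q) (v := z), SimpleGraph.dist_comm (u := q) (v := c')] at h4'
  rw [SimpleGraph.dist_comm (u := d) (v := z)] at h4
  rw [SimpleGraph.dist_comm (u := c) (v := c')] at e2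
  omega

theorem exists_halfspace (hX : X.IsCAT0) {x y : α} (h : x ≠ y) :
    ∃ K, X.IsHalfspace K ∧ x ∈ K ∧ y ∉ K := by
  obtain ⟨x', h1, h2⟩ := exists_adj_closer hX h
  refine ⟨_, ⟨x, x', h1, rfl⟩, left_mem_side h1, ?_⟩
  rw [mem_side, SimpleGraph.dist_comm, SimpleGraph.dist_comm (u := y)]
  omega

/-! ### Gates and Helly's theorem -/

/-- `p` is the gate of `z` in `A`: every vertex of `A` is joined to `z` by a geodesic through
`p`. -/
def IsGate (X : CubeComplex α) (A : Set α) (z p : α) : Prop :=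
  p ∈ A ∧ ∀ y ∈ A, X.graph.dist z y = X.graph.dist z p + X.graph.dist p y

/-- In a convex set the closest vertex is a gate. -/
theorem IsConvex.isGate (hX : X.IsCAT0) {A : Set α} (hA : X.IsConvex A) {z p : α} (hp : p ∈ A)
    (hmin : ∀ y ∈ A, X.graph.dist z p ≤ X.graph.dist z y) : X.IsGate A z p := by
  refine ⟨hp, fun y hy => ?_⟩
  induction hn : X.graph.dist p y using Nat.strong_induction_on generalizing y with
  | _ n ih =>
    by_cases hyp : y = p
    · subst hyp
      rw [SimpleGraph.dist_self] at hn
      omega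
    obtain ⟨y', h1, h2⟩ := exists_adj_closer hX hyp
    have hy' : y' ∈ A := hA y hy p hp y' (by rw [dist_eq_one h1]; omega)
    rw [SimpleGraph.dist_comm (u := y), SimpleGraph.dist_comm (u := y')] at h2
    have h3 := ih _ (by omega) y' hy' rfl
    rcases hX.dist_adj_cases z h1 with h4 | h4
    · omega
    -- otherwise `y` is closer to `z` than `y'`, which the quadrangle condition at `y'` excludes
    exfalso
    have h5 := hmin y hy
    have hy'p : y' ≠ p := by
      rintro rfl
      omega
    obtain ⟨y'', h6, h7⟩ := exists_adj_closer hX hy'p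
    have hy'' : y'' ∈ A := hA y' hy' p hp y'' (by rw [dist_eq_one h6]; omega)
    rw [SimpleGraph.dist_comm (u := y''), SimpleGraph.dist_comm (u := y')] at h7
    have h8 := ih _ (by omega) y'' hy'' rfl
    have hne : y ≠ y'' := by rintro rfl; omega
    obtain ⟨w, hs, h9, h10⟩ := hX.quadrangle (o := z) h1.symm h6 hne (by omega) (by omega)
    have hw : w ∈ A := by
      refine hA y hy y'' hy'' w ?_
      rw [dist_eq_one hs.2.2.1, dist_eq_one hs.2.2.2.1]
      have e1 := (connected hX).dist_triangle (u := y) (v := w) (w := y'')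
      rw [dist_eq_one hs.2.2.1, dist_eq_one hs.2.2.2.1] at e1
      have e2 := (connected hX).dist_triangle (u := p) (v := y'') (w := y)
      rw [SimpleGraph.dist_comm (u := y'')] at e2
      omega
    have h11 := hX.dist_adj_cases p hs.2.2.1
    have h12 := hX.dist_adj_cases p hs.2.2.2.1
    have h13 := ih _ (by omega) w hw rfl
    omega

theorem ConvexSubcomplex.exists_isGate (hX : X.IsCAT0) {A : Set α} (hA : X.ConvexSubcomplex A)
    (z : α) : ∃ p, X.IsGate A z p := by
  obtain ⟨p, hp, hmin⟩ : ∃ p ∈ A, ∀ y ∈ A, X.graph.dist z p ≤ X.graph.dist z y :=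
    ⟨_, Function.argminOn_mem (X.graph.dist z) A hA.1, fun _ => Function.argminOn_le _ A⟩
  exact ⟨p, hA.isConvex.isGate hX hp hmin⟩

theorem IsGate.mem {A K : Set α} {z p : α} (h : X.IsGate A z p) (hK : X.IsConvex K)
    (hz : z ∈ K) (hA : (A ∩ K).Nonempty) : p ∈ K := by
  obtain ⟨y, hy, hyK⟩ := hA
  exact hK z hz y hyK p (h.2 y hy).symm

theorem mem_gateImage_iff (hX : X.IsCAT0) {A B : Set α} (hA : X.IsConvex A) {y : α} :
    y ∈ X.gateImage A B ↔ ∃ x ∈ B, X.IsGate A x y := by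
  constructor
  · rintro ⟨hy, x, hx, h⟩
    exact ⟨x, hx, hA.isGate hX hy h⟩
  · rintro ⟨x, hx, h⟩
    refine ⟨h.1, x, hx, fun z hz => ?_⟩
    rw [h.2 z hz]
    omega

/-- A convex subcomplex is the intersection of the halfspaces that contain it. -/
theorem ConvexSubcomplex.mem_of_forall (hX : X.IsCAT0) {A : Set α} (hA : X.ConvexSubcomplex A)
    {z : α} (h : ∀ K, X.IsHalfspace K → A ⊆ K → z ∈ K) : z ∈ A := by
  obtain ⟨p, hp⟩ := hA.exists_isGate hX z
  by_contra hz
  obtain ⟨K, hK, hpK, hzK⟩ := exists_halfspace hX (x := p) (y := z) fun e => hz (e ▸ hp.1)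
  refine hzK (h K hK fun y hy => ?_)
  by_contra hyK
  exact hp.mem ((hK.compl hX).isConvex hX) hzK ⟨y, hy, hyK⟩ hpK

theorem isConvex_of_forall (hX : X.IsCAT0) {A : Set α}
    (h : ∀ z, (∀ K, X.IsHalfspace K → A ⊆ K → z ∈ K) → z ∈ A) : X.IsConvex A :=
  fun a ha b hb w hw => h w fun _ hK hAK => hK.isConvex hX a (hAK ha) b (hAK hb) w hw

/-- Helly's theorem for three convex sets. -/
theorem helly_three (hX : X.IsCAT0) {A B C : Set α} (hA : X.IsConvex A) (hB : X.IsConvex B)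
    (hC : X.IsConvex C) (hAB : (A ∩ B).Nonempty) (hAC : (A ∩ C).Nonempty)
    (hBC : (B ∩ C).Nonempty) : (A ∩ B ∩ C).Nonempty := by
  obtain ⟨z, hzB, hzC⟩ := hBC
  obtain ⟨p, hp⟩ := ConvexSubcomplex.exists_isGate hX (A := A)
    ⟨hAB.mono Set.inter_subset_left, hA⟩ z
  exact ⟨p, ⟨hp.1, hp.mem hB hzB hAB⟩, hp.mem hC hzC hAC⟩

/-- Helly's theorem for finite families. The extra convex set `B` absorbs, one after the other, the
members of the family. -/
theorem helly (hX : X.IsCAT0) {S : Set (Set α)} (hS : S.Finite) (hconv : ∀ A ∈ S, X.IsConvex A)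
    (hint : ∀ A ∈ S, ∀ A' ∈ S, (A ∩ A').Nonempty) {B : Set α} (hB : X.IsConvex B)
    (hB' : B.Nonempty) (hBS : ∀ A ∈ S, (B ∩ A).Nonempty) : ∃ z ∈ B, ∀ A ∈ S, z ∈ A := by
  induction S, hS using Set.Finite.induction_on generalizing B with
  | empty =>
    obtain ⟨z, hz⟩ := hB'
    exact ⟨z, hz, by simp⟩
  | @insert A S _ _ ih =>
    have hA := hconv A (by simp)
    obtain ⟨z, hz, h⟩ := ih (fun A hA => hconv A (by simp [hA]))
      (fun A hA A' hA' => hint A (by simp [hA]) A' (by simp [hA'])) (hB.inter hA)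
      (hBS A (by simp)) fun A' hA' => helly_three hX hB hA (hconv A' (by simp [hA']))
        (hBS A (by simp)) (hBS A' (by simp [hA'])) (hint A (by simp) A' (by simp [hA']))
    refine ⟨z, hz.1, ?_⟩
    rintro A' (rfl | hA')
    · exact hz.2
    · exact h A' hA'

theorem finite_separating (hX : X.IsCAT0) (x y : α) :
    {K | X.IsHalfspace K ∧ y ∈ K ∧ x ∉ K}.Finite := by
  induction hn : X.graph.dist x y generalizing x with
  | zero =>
    rw [((connected hX).dist_eq_zero_iff).1 hn]
    refine Set.finite_empty.subset ?_
    rintro K ⟨-, h1, h2⟩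
    exact h2 h1
  | succ n ih =>
    obtain ⟨x', h1, h2⟩ := exists_adj_closer hX (x := x) (y := y) (by rintro rfl; simp at hn)
    refine ((ih x' (by omega)).insert (X.side x' x)).subset ?_
    rintro K ⟨hK, h3, h4⟩
    by_cases h5 : x' ∈ K
    · exact .inl (hK.eq_side hX h1.symm h5 h4)
    · exact .inr ⟨hK, h3, h5⟩

/-! ### Hyperplanes, parallelism and gate images in terms of halfspaces -/

/-- The hyperplane bounding `K` crosses `A`: both `K` and its complement meet `A`. -/
def Cuts (K A : Set α) : Prop := (A ∩ K).Nonempty ∧ (A ∩ Kᶜ).Nonempty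

theorem Cuts.mono {K A B : Set α} (h : Cuts K A) (hAB : A ⊆ B) : Cuts K B :=
  ⟨h.1.mono (Set.inter_subset_inter_left _ hAB), h.2.mono (Set.inter_subset_inter_left _ hAB)⟩

theorem cuts_compl {K A : Set α} : Cuts Kᶜ A ↔ Cuts K A := by
  rw [Cuts, Cuts, compl_compl, and_comm]

theorem cuts_of_mem {K A : Set α} {x y : α} (hx : x ∈ A) (hy : y ∈ A) (h : ¬ (x ∈ K ↔ y ∈ K)) :
    Cuts K A := by
  by_cases hxK : x ∈ K
  · exact ⟨⟨x, hx, hxK⟩, ⟨y, hy, fun hyK => h (iff_of_true hxK hyK)⟩⟩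
  · by_cases hyK : y ∈ K
    · exact ⟨⟨y, hy, hyK⟩, ⟨x, hx, hxK⟩⟩
    · exact absurd (iff_of_false hxK hyK) h

theorem mem_iff_of_not_cuts {K A : Set α} (h : ¬ Cuts K A) {x y : α} (hx : x ∈ A) (hy : y ∈ A) :
    x ∈ K ↔ y ∈ K := by
  by_contra hxy
  exact h (cuts_of_mem hx hy hxy)

/-- The hyperplanes bounding `K` and `L` cross: all four quarterspaces are nonempty. -/
def Transverse (K L : Set α) : Prop := Cuts L K ∧ Cuts L Kᶜ

theorem Transverse.symm {K L : Set α} (h : Transverse K L) : Transverse L K := by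
  obtain ⟨⟨h1, h2⟩, h3, h4⟩ := h
  rw [Set.inter_comm] at h1 h2 h3 h4
  exact ⟨⟨h1, h3⟩, h2, h4⟩

theorem Transverse.compl_left {K L : Set α} (h : Transverse K L) : Transverse Kᶜ L :=
  ⟨h.2, by rw [compl_compl]; exact h.1⟩

theorem transverse_compl_left {K L : Set α} : Transverse Kᶜ L ↔ Transverse K L :=
  ⟨fun h => by simpa using h.compl_left, fun h => h.compl_left⟩

theorem not_transverse_self (K : Set α) : ¬ Transverse K K := by
  rintro ⟨⟨-, x, h1, h2⟩, -⟩
  exact h2 h1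

theorem Crosses.cuts (hX : X.IsCAT0) {A : Set α} (hab : X.graph.Adj a b)
    (h : Crosses (X.hyperplane a b) A) : Cuts (X.side a b) A := by
  obtain ⟨c, hc, d, hd, ⟨e, f⟩, he, heq⟩ := h
  have hs := he.side_eq hX
  have hadj : X.graph.Adj e f := he.adj_iff.1 hab
  simp only at hs
  have h1 : e ∈ X.side a b := hs ▸ left_mem_side hadj
  have h2 : f ∉ X.side a b := hs ▸ right_notMem_side hX hadj
  rcases Sym2.eq_iff.1 heq with ⟨rfl, rfl⟩ | ⟨rfl, rfl⟩
  · exact ⟨⟨c, hc, h1⟩, d, hd, h2⟩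
  · exact ⟨⟨d, hd, h1⟩, c, hc, h2⟩

theorem Cuts.exists_adj (hX : X.IsCAT0) {A K : Set α} (hA : X.IsConvex A) (h : Cuts K A) :
    ∃ c ∈ A, ∃ d ∈ A, X.graph.Adj c d ∧ c ∈ K ∧ d ∉ K := by
  obtain ⟨⟨p, hp, hpK⟩, q, hq, hqK⟩ := h
  obtain ⟨c, d, h1, h2, h3, h4⟩ := exists_edge_between hX hpK hqK
  have e1 := (connected hX).dist_triangle (u := p) (v := c) (w := q)
  have e2 := (connected hX).dist_triangle (u := c) (v := d) (w := q)
  have e3 := (connected hX).dist_triangle (u := p) (v := d) (w := q)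
  have e4 := (connected hX).dist_triangle (u := p) (v := c) (w := d)
  rw [dist_eq_one h1] at e2 e4
  exact ⟨c, hA p hp q hq c (by omega), d, hA p hp q hq d (by omega), h1, h2, h3⟩

theorem crosses_hyperplane_iff (hX : X.IsCAT0) {A : Set α} (hA : X.IsConvex A)
    (hab : X.graph.Adj a b) : Crosses (X.hyperplane a b) A ↔ Cuts (X.side a b) A := by
  refine ⟨Crosses.cuts hX hab, fun h => ?_⟩
  obtain ⟨c, hc, d, hd, h1, h2, h3⟩ := h.exists_adj hX hA
  exact ⟨c, hc, d, hd, (c, d), orientedParallel_of_mem hX hab h1 h2 h3, rfl⟩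

theorem parallel_iff (hX : X.IsCAT0) {A B : Set α} (hA : X.IsConvex A) (hB : X.IsConvex B) :
    X.Parallel A B ↔ ∀ K, X.IsHalfspace K → (Cuts K A ↔ Cuts K B) := by
  constructor
  · rintro h K ⟨a, b, hab, rfl⟩
    rw [← crosses_hyperplane_iff hX hA hab, ← crosses_hyperplane_iff hX hB hab]
    exact h _ ⟨a, b, hab, rfl⟩
  · rintro h H ⟨a, b, hab, rfl⟩
    rw [crosses_hyperplane_iff hX hA hab, crosses_hyperplane_iff hX hB hab]
    exact h _ ⟨a, b, hab, rfl⟩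

theorem mem_combinatorialHyperplane_iff (hX : X.IsCAT0) (hab : X.graph.Adj a b) {v : α} :
    v ∈ X.combinatorialHyperplane a b ↔
      v ∈ X.side a b ∧ ∃ w, X.graph.Adj v w ∧ w ∉ X.side a b := by
  constructor
  · rintro ⟨w, hw⟩
    have hs := hw.side_eq hX
    have hadj : X.graph.Adj v w := hw.adj_iff.1 hab
    simp only at hs
    refine ⟨hs ▸ left_mem_side hadj, w, hadj, ?_⟩
    exact hs ▸ right_notMem_side hX hadj
  · rintro ⟨hv, w, hvw, hw⟩
    exact ⟨w, orientedParallel_of_mem hX hab hvw hv hw⟩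

theorem convexSubcomplex_combinatorialHyperplane (hX : X.IsCAT0) (hab : X.graph.Adj a b) :
    X.ConvexSubcomplex (X.combinatorialHyperplane a b) := by
  refine ⟨⟨a, b, .refl _⟩, ?_⟩
  have hS : X.IsHalfspace (X.side a b) := ⟨a, b, hab, rfl⟩
  intro v₁ hv₁ v₂ hv₂ y hy
  rw [mem_combinatorialHyperplane_iff hX hab] at *
  obtain ⟨h1, w₁, ha1, hw1⟩ := hv₁
  obtain ⟨h2, w₂, ha2, hw2⟩ := hv₂
  have hyS := hS.isConvex hX v₁ h1 v₂ h2 y hy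
  refine ⟨hyS, ?_⟩
  obtain ⟨w, hw⟩ := ConvexSubcomplex.exists_isGate hX (A := (X.side a b)ᶜ)
    ⟨⟨w₁, hw1⟩, (hS.compl hX).isConvex hX⟩ y
  have hne : y ≠ w := fun h => hw.1 (h ▸ hyS)
  obtain ⟨y', hadj, hy'⟩ := exists_adj_closer hX hne
  refine ⟨y', hadj, ?_⟩
  -- the hyperplane crossed by the first edge on the way to the complementary halfspace separates
  -- `v₁` from `w₁` or `v₂` from `w₂`, so it is the given one
  have hK : X.IsHalfspace (X.side y y') := ⟨y, y', hadj, rfl⟩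
  have hyK := left_mem_side hadj
  have hwK : w ∉ X.side y y' := by
    rw [mem_side, SimpleGraph.dist_comm, SimpleGraph.dist_comm (u := w)]
    omega
  have key : ∀ v w', v ∈ X.side a b → X.graph.Adj v w' → w' ∉ X.side a b → v ∈ X.side y y' →
      X.side a b = X.side y y' := by
    intro v w' hv hvw hw' hvK
    rw [hS.eq_side hX hvw hv hw', hK.eq_side hX hvw hvK fun h =>
      hwK (hw.mem (hK.isConvex hX) hyK ⟨w', hw', h⟩)]
  have hside : X.side a b = X.side y y' := by
    by_cases hv1 : v₁ ∈ X.side y y'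
    · exact key v₁ w₁ h1 ha1 hw1 hv1
    by_cases hv2 : v₂ ∈ X.side y y'
    · exact key v₂ w₂ h2 ha2 hw2 hv2
    · exact absurd hyK ((hK.compl hX).isConvex hX v₁ hv1 v₂ hv2 y hy)
  exact hside ▸ right_notMem_side hX hadj

/-- A combinatorial hyperplane is cut by the hyperplanes that cross the hyperplane it bounds. -/
theorem cuts_combinatorialHyperplane_iff (hX : X.IsCAT0) (hab : X.graph.Adj a b) {K : Set α}
    (hK : X.IsHalfspace K) :
    Cuts K (X.combinatorialHyperplane a b) ↔ Transverse (X.side a b) K := by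
  have hS : X.IsHalfspace (X.side a b) := ⟨a, b, hab, rfl⟩
  constructor
  · rintro ⟨⟨v₁, hv₁, hk1⟩, v₂, hv₂, hk2⟩
    rw [mem_combinatorialHyperplane_iff hX hab] at *
    obtain ⟨h1, w₁, ha1, hw1⟩ := hv₁
    obtain ⟨h2, w₂, ha2, hw2⟩ := hv₂
    refine ⟨⟨⟨v₁, h1, hk1⟩, v₂, h2, hk2⟩, ⟨w₁, hw1, ?_⟩, w₂, hw2, ?_⟩
    · by_contra h
      rw [hK.eq_side hX ha1 hk1 h, ← hS.eq_side hX ha1 h1 hw1] at hk2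
      exact hk2 h2
    · intro h
      have := (hK.compl hX).eq_side hX ha2 hk2 (fun h' => h' h)
      rw [← hS.eq_side hX ha2 h2 hw2] at this
      rw [← this] at h1
      exact h1 hk1
  · have aux : ∀ L, X.IsConvex L → (X.side a b ∩ L).Nonempty → ((X.side a b)ᶜ ∩ L).Nonempty →
        (X.combinatorialHyperplane a b ∩ L).Nonempty := by
      rintro L hL ⟨p, hp, hpL⟩ ⟨q, hq, hqL⟩
      obtain ⟨c, d, h1, h2, h3, h4⟩ := exists_edge_between hX hp hq
      have e1 := (connected hX).dist_triangle (u := p) (v := c) (w := q)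
      have e2 := (connected hX).dist_triangle (u := c) (v := d) (w := q)
      rw [dist_eq_one h1] at e2
      exact ⟨c, (mem_combinatorialHyperplane_iff hX hab).2 ⟨h2, d, h1, h3⟩,
        hL p hpL q hqL c (by omega)⟩
    rintro ⟨⟨h1, h2⟩, h3, h4⟩
    exact ⟨aux _ (hK.isConvex hX) h1 h3, aux _ ((hK.compl hX).isConvex hX) h2 h4⟩

theorem convexSubcomplex_gateImage (hX : X.IsCAT0) {A B : Set α} (hA : X.ConvexSubcomplex A)
    (hB : X.ConvexSubcomplex B) : X.ConvexSubcomplex (X.gateImage A B) := by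
  constructor
  · obtain ⟨z, hz⟩ := hB.1
    obtain ⟨p, hp⟩ := hA.exists_isGate hX z
    exact ⟨p, (mem_gateImage_iff hX hA.isConvex).2 ⟨z, hz, hp⟩⟩
  intro p₁ hp₁ p₂ hp₂ y hy
  rw [mem_gateImage_iff hX hA.isConvex] at *
  obtain ⟨z₁, hz₁, h1⟩ := hp₁
  obtain ⟨z₂, hz₂, h2⟩ := hp₂
  have hyA := hA.isConvex p₁ h1.1 p₂ h2.1 y hy
  -- `y` is the gate of its own gate `z` in `B`
  obtain ⟨z, hz⟩ := hB.exists_isGate hX y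
  obtain ⟨y', hy'⟩ := hA.exists_isGate hX z
  by_cases hne : y = y'
  · exact ⟨z, hz.1, hne ▸ hy'⟩
  exfalso
  obtain ⟨K, hK, hyK, hyK'⟩ := exists_halfspace hX hne
  have hc := (hK.compl hX).isConvex hX
  have hzK : z ∉ K := fun h => hyK' (hy'.mem (hK.isConvex hX) h ⟨y, hyA, hyK⟩)
  have hBK : ∀ x ∈ B, x ∉ K := fun x hx h => hzK (hz.mem (hK.isConvex hX) hyK ⟨x, hx, h⟩)
  exact hc p₁ (h1.mem hc (hBK _ hz₁) ⟨y', hy'.1, hyK'⟩) p₂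
    (h2.mem hc (hBK _ hz₂) ⟨y', hy'.1, hyK'⟩) y hy hyK

/-- The gate image of `B` in `A` is cut by the hyperplanes that cut both `A` and `B`. -/
theorem cuts_gateImage_iff (hX : X.IsCAT0) {A B K : Set α} (hA : X.ConvexSubcomplex A)
    (hK : X.IsHalfspace K) : Cuts K (X.gateImage A B) ↔ Cuts K A ∧ Cuts K B := by
  have hK1 := hK.isConvex hX
  have hK2 := (hK.compl hX).isConvex hX
  constructor
  · rintro ⟨⟨p₁, hp₁, h1⟩, p₂, hp₂, h2⟩
    rw [mem_gateImage_iff hX hA.isConvex] at hp₁ hp₂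
    obtain ⟨z₁, hz₁, g1⟩ := hp₁
    obtain ⟨z₂, hz₂, g2⟩ := hp₂
    refine ⟨⟨⟨p₁, g1.1, h1⟩, p₂, g2.1, h2⟩, ⟨z₁, hz₁, ?_⟩, z₂, hz₂, ?_⟩
    · by_contra h
      exact g1.mem hK2 h ⟨p₂, g2.1, h2⟩ h1
    · intro h
      exact h2 (g2.mem hK1 h ⟨p₁, g1.1, h1⟩)
  · rintro ⟨⟨h1, h2⟩, ⟨z₁, hz₁, h3⟩, z₂, hz₂, h4⟩
    obtain ⟨p₁, g1⟩ := hA.exists_isGate hX z₁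
    obtain ⟨p₂, g2⟩ := hA.exists_isGate hX z₂
    exact ⟨⟨p₁, (mem_gateImage_iff hX hA.isConvex).2 ⟨z₁, hz₁, g1⟩, g1.mem hK1 h3 h1⟩,
      p₂, (mem_gateImage_iff hX hA.isConvex).2 ⟨z₂, hz₂, g2⟩, g2.mem hK2 h4 h2⟩

theorem gateImage_subset (A B : Set α) : X.gateImage A B ⊆ A := fun _ h => h.1

theorem isHyperclosed_setOf_convexSubcomplex (hX : X.IsCAT0) :
    X.IsHyperclosed {A | X.ConvexSubcomplex A} where
  convex _ h := h
  univ_mem := ⟨(connected hX).nonempty.elim fun a => ⟨a, trivial⟩, fun _ _ _ _ _ _ => trivial⟩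
  combinatorialHyperplane_mem _ _ h := convexSubcomplex_combinatorialHyperplane hX h
  gateImage_mem _ hA _ hB := convexSubcomplex_gateImage hX hA hB
  parallel_mem _ _ _ hB _ := hB

theorem isHyperclosed_hyperclosure (hX : X.IsCAT0) : X.IsHyperclosed X.hyperclosure where
  convex _ h := h _ (isHyperclosed_setOf_convexSubcomplex hX)
  univ_mem := fun _ h => h.univ_mem
  combinatorialHyperplane_mem a b hab := fun _ h => h.combinatorialHyperplane_mem a b hab
  gateImage_mem A hA B hB := fun _ h => h.gateImage_mem A (hA _ h) B (hB _ h)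
  parallel_mem A hA B hB hBA := fun _ h => h.parallel_mem A (hA _ h) B hB hBA

/-! ### Orthogonal complements -/

/-- The orthogonal complement of `V` at `x`: the vertices that are separated from `x` only by
hyperplanes that cross every hyperplane of `V`. -/
def orthogonal (X : CubeComplex α) (V : Set α) (x : α) : Set α :=
  {y | ∀ K, X.IsHalfspace K → x ∈ K → y ∉ K →
    ∀ L, X.IsHalfspace L → Cuts L V → Transverse K L}

theorem self_mem_orthogonal (V : Set α) (x : α) : x ∈ X.orthogonal V x :=
  fun _ _ h h' => absurd h h'

theorem convexSubcomplex_orthogonal (hX : X.IsCAT0) (V : Set α) (x : α) :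
    X.ConvexSubcomplex (X.orthogonal V x) := by
  refine ⟨⟨x, self_mem_orthogonal V x⟩, fun y₁ h1 y₂ h2 z hz K hK hxK hzK => ?_⟩
  by_cases hy₁ : y₁ ∈ K
  · by_cases hy₂ : y₂ ∈ K
    · exact absurd (hK.isConvex hX y₁ hy₁ y₂ hy₂ z hz) hzK
    · exact h2 K hK hxK hy₂
  · exact h1 K hK hxK hy₁

theorem transverse_of_mem_orthogonal (hX : X.IsCAT0) {V K L : Set α} {x y : α}
    (hy : y ∈ X.orthogonal V x) (hK : X.IsHalfspace K) (hxy : ¬ (x ∈ K ↔ y ∈ K))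
    (hL : X.IsHalfspace L) (hLV : Cuts L V) : Transverse K L := by
  by_cases hxK : x ∈ K
  · exact hy K hK hxK (by tauto) L hL hLV
  · exact transverse_compl_left.1 (hy Kᶜ (hK.compl hX) hxK
      (by rw [Set.mem_compl_iff]; tauto) L hL hLV)

/-- A hyperplane that crosses all hyperplanes of `V` crosses the orthogonal complement of `V`. -/
theorem cuts_orthogonal_of_transverse (hX : X.IsCAT0) {V : Set α} {x : α} (hx : x ∈ V)
    {K : Set α} (hK : X.IsHalfspace K) (hxK : x ∈ K)
    (h : ∀ L, X.IsHalfspace L → Cuts L V → Transverse K L) : Cuts K (X.orthogonal V x) := by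
  refine ⟨⟨x, self_mem_orthogonal V x, hxK⟩, ?_⟩
  obtain ⟨a, b, hab, rfl⟩ := hK
  have hK : X.IsHalfspace (X.side a b) := ⟨a, b, hab, rfl⟩
  have hA := convexSubcomplex_combinatorialHyperplane hX hab
  obtain ⟨y, hy⟩ := hA.exists_isGate hX x
  obtain ⟨hyK, w, hyw, hw⟩ := (mem_combinatorialHyperplane_iff hX hab).1 hy.1
  refine ⟨w, fun M hM hxM hwM L hL hLV => ?_, hw⟩
  by_cases hyM : y ∈ M
  · rw [hM.eq_side hX hyw hyM hwM, ← hK.eq_side hX hyw hyK hw]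
    exact h L hL hLV
  -- `M` separates `x`, hence all of `V`, from the combinatorial hyperplane, and `L` cuts both
  have hdisj : ∀ z ∈ X.combinatorialHyperplane a b, z ∉ M := fun z hz hzM =>
    hyM (hy.mem (hM.isConvex hX) hxM ⟨z, hz, hzM⟩)
  have hVM : V ⊆ M := by
    intro v hv
    by_contra hvM
    have := (cuts_combinatorialHyperplane_iff hX hab hM).2 (h M hM ⟨⟨x, hx, hxM⟩, v, hv, hvM⟩)
    obtain ⟨z, hz, hzM⟩ := this.1
    exact hdisj z hz hzM
  exact ⟨hLV.mono hVM,
    ((cuts_combinatorialHyperplane_iff hX hab hL).2 (h L hL hLV)).mono hdisj⟩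

theorem cuts_orthogonal_iff (hX : X.IsCAT0) {V : Set α} {x : α} (hx : x ∈ V) {K : Set α}
    (hK : X.IsHalfspace K) :
    Cuts K (X.orthogonal V x) ↔ ∀ L, X.IsHalfspace L → Cuts L V → Transverse K L := by
  constructor
  · rintro ⟨⟨y, hy, hyK⟩, z, hz, hzK⟩ L hL hLV
    by_cases hxK : x ∈ K
    · exact transverse_of_mem_orthogonal hX hz hK (by tauto) hL hLV
    · exact transverse_of_mem_orthogonal hX hy hK (by tauto) hL hLV
  · intro h
    by_cases hxK : x ∈ K
    · exact cuts_orthogonal_of_transverse hX hx hK hxK h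
    · exact cuts_compl.1 (cuts_orthogonal_of_transverse hX hx (hK.compl hX) hxK
        fun L hL hLV => (h L hL hLV).compl_left)

theorem not_exists_strictAnti (hX : X.IsCAT0) (hfactor : X.HasFactorSystem) (Y : ℕ → Set α)
    (hY : ∀ n, Y n ∈ X.hyperclosure) (hanti : StrictAnti Y) : False := by
  obtain ⟨ξ, hξ⟩ := hfactor
  obtain ⟨x, hx⟩ := ((isHyperclosed_hyperclosure hX).convex _ (hY ξ)).1
  have hsub : Y '' Set.Iic ξ ⊆ {A | A ∈ X.hyperclosure ∧ x ∈ A} := by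
    rintro _ ⟨n, hn, rfl⟩
    exact ⟨hY n, hanti.antitone hn hx⟩
  have h1 := (Set.encard_le_encard hsub).trans (hξ x)
  rw [hanti.injective.encard_image, ← Finset.coe_Iic, Set.encard_coe_eq_coe_finsetCard,
    Nat.card_Iic] at h1
  have h2 : ξ + 1 ≤ ξ := by exact_mod_cast h1
  omega

/-- Orthogonal complements of arbitrary sets belong to a hyperclosure with finite multiplicity.
Among the elements of the hyperclosure that are cut by all hyperplanes of the complement, one that
is not parallel to it has a smaller one inside it: if `K` cuts `Y` but does not cross the
hyperplane of `V` dual to the edge `ab`, then the gate image in `Y` of a combinatorial hyperplane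
at `ab` is not cut by `K`. Descending chains in the hyperclosure have bounded length. -/
theorem orthogonal_mem_hyperclosure (hX : X.IsCAT0) (hfactor : X.HasFactorSystem) {V : Set α}
    {x : α} (hx : x ∈ V) : X.orthogonal V x ∈ X.hyperclosure := by
  have hc := isHyperclosed_hyperclosure hX
  have hV := convexSubcomplex_orthogonal hX V x
  by_contra hcon
  let P := {Y : Set α // Y ∈ X.hyperclosure ∧
    ∀ K, X.IsHalfspace K → Cuts K (X.orthogonal V x) → Cuts K Y}
  have step : ∀ Y : P, ∃ Y' : P, Y'.1 ⊂ Y.1 := by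
    rintro ⟨Y, hY, hYK⟩
    have hYc := hc.convex _ hY
    have hnot : ¬ ∀ K, X.IsHalfspace K → Cuts K Y → Cuts K (X.orthogonal V x) := fun h =>
      hcon (hc.parallel_mem Y hY _ hV ((parallel_iff hX hV.isConvex hYc.isConvex).2
        fun K hK => ⟨hYK K hK, h K hK⟩))
    push Not at hnot
    obtain ⟨K, hK, hKY, hKV⟩ := hnot
    rw [cuts_orthogonal_iff hX hx hK] at hKV
    push Not at hKV
    obtain ⟨L, ⟨a, b, hab, rfl⟩, hLV, hLK⟩ := hKV
    have hA := hc.combinatorialHyperplane_mem a b hab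
    refine ⟨⟨X.gateImage Y (X.combinatorialHyperplane a b), hc.gateImage_mem _ hY _ hA,
      fun M hM hMV => (cuts_gateImage_iff hX hYc hM).2 ⟨hYK M hM hMV,
        (cuts_combinatorialHyperplane_iff hX hab hM).2
          ((cuts_orthogonal_iff hX hx hM).1 hMV _ ⟨a, b, hab, rfl⟩ hLV).symm⟩⟩, ?_⟩
    refine (gateImage_subset _ _).ssubset_of_ne fun he => ?_
    rw [← he, cuts_gateImage_iff hX hYc hK, cuts_combinatorialHyperplane_iff hX hab hK] at hKY
    exact hLK hKY.2.symm
  choose next hnext using step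
  let Y : ℕ → P := fun n => next^[n]
    ⟨Set.univ, hc.univ_mem, fun K _ h => h.mono (Set.subset_univ _)⟩
  refine not_exists_strictAnti hX hfactor (fun n => (Y n).1) (fun n => (Y n).2.1)
    (strictAnti_nat_of_succ_lt fun n => ?_)
  simp only [Y, Function.iterate_succ_apply']
  exact hnext _

/-! ### Cubes as convex sets -/

theorem flip_induction {n : ℕ} {p : (Fin n → Bool) → Prop} {x : Fin n → Bool} (hx : p x)
    (h : ∀ y i, p y → p (flip i y)) (y : Fin n → Bool) : p y := by
  suffices ∀ (s : Finset (Fin n)) (y : Fin n → Bool), (∀ k, y k ≠ x k → k ∈ s) → p y from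
    this Finset.univ y fun k _ => Finset.mem_univ k
  intro s
  induction s using Finset.induction_on with
  | empty =>
    intro y hy
    have : y = x := by
      ext k
      by_contra hk
      exact absurd (hy k (by simpa using hk)) (Finset.notMem_empty k)
    exact this ▸ hx
  | insert j s _ ih =>
    intro y hy
    by_cases hj : y j = x j
    · refine ih y fun k hk => Finset.mem_of_mem_insert_of_ne (hy k hk) ?_
      rintro rfl
      exact hk hj
    · rw [← flip_flip j y]
      refine h _ j (ih _ fun k hk => ?_)
      by_cases hkj : k = j
      · subst hkj
        rw [flip_same] at hk
        cases h1 : y k <;> cases h2 : x k <;> simp_all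
      · rw [flip_of_ne hkj] at hk
        exact Finset.mem_of_mem_insert_of_ne (hy k hk) hkj

namespace IsChart

variable {C : Set α} {n : ℕ} {f : (Fin n → Bool) → α}

open Classical in
/-- Parallel edges of a cube bound the same halfspace, up to orientation. -/
theorem side_flip (hX : X.IsCAT0) (hf : X.IsChart C f) (x : Fin n → Bool) (i : Fin n)
    (y : Fin n → Bool) : X.side (f y) (f (flip i y)) =
      if y i = x i then X.side (f x) (f (flip i x)) else (X.side (f x) (f (flip i x)))ᶜ := by
  induction y using flip_induction (x := x) with
  | hx => simp
  | h y j ih =>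
    by_cases hj : j = i
    · subst hj
      rw [flip_flip, ← compl_side hX (hf.adj_flip y j), ih, flip_same]
      cases h1 : y j <;> cases h2 : x j <;> simp
    · rw [flip_of_ne (Ne.symm hj), ← ih, side_eq_of_square hX (hf.square_flip y (Ne.symm hj)),
        flip_comm]

theorem mem_side_iff (hX : X.IsCAT0) (hf : X.IsChart C f) (x : Fin n → Bool) (i : Fin n)
    (y : Fin n → Bool) : f y ∈ X.side (f x) (f (flip i x)) ↔ y i = x i := by
  have h := hf.side_flip hX x i y
  have h1 := left_mem_side (hf.adj_flip y i)
  by_cases hi : y i = x i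
  · rw [if_pos hi] at h
    exact iff_of_true (h ▸ h1) hi
  · rw [if_neg hi] at h
    exact iff_of_false (Set.mem_compl_iff _ _ |>.1 (h ▸ h1)) hi

theorem exists_eq_side (hX : X.IsCAT0) (hf : X.IsChart C f) {K : Set α} (hK : X.IsHalfspace K)
    {x : Fin n → Bool} (hx : f x ∈ K) (h : ¬ C ⊆ K) :
    ∃ i, K = X.side (f x) (f (flip i x)) := by
  by_contra! hcon
  refine h ?_
  rw [← hf.range_eq]
  rintro _ ⟨y, rfl⟩
  induction y using flip_induction (x := x) with
  | hx => exact hx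
  | h y i hy =>
    by_contra hi
    have h1 := hK.eq_side hX (hf.adj_flip y i) hy hi
    have h2 := hf.side_flip hX x i y
    rw [if_pos ((hf.mem_side_iff hX y i x).1 (h1 ▸ hx)).symm] at h2
    exact hcon i (h1.trans h2)

theorem convexSubcomplex (hX : X.IsCAT0) (hf : X.IsChart C f) : X.ConvexSubcomplex C := by
  classical
  let x : Fin n → Bool := fun _ => false
  refine ⟨⟨f x, hf.mem x⟩, isConvex_of_forall hX fun z hz => ?_⟩
  let y : Fin n → Bool := fun i => if z ∈ X.side (f x) (f (flip i x)) then x i else !x i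
  by_contra hzC
  obtain ⟨K, hK, hyK, hzK⟩ := exists_halfspace hX (x := f y) (y := z) fun h =>
    hzC (h ▸ hf.mem y)
  obtain ⟨i, rfl⟩ := hf.exists_eq_side hX hK hyK fun h => hzK (hz K hK h)
  rw [hf.side_flip hX x i y] at hzK
  by_cases hi : z ∈ X.side (f x) (f (flip i x)) <;> simp [y, hi] at hzK

end IsChart

/-- The cubes of `X` are the convex sets whose hyperplanes pairwise cross. -/
theorem mem_cubes_iff (hX : X.IsCAT0) (hproper : X.IsProper) {C : Set α} :
    C ∈ X.cubes ↔ X.ConvexSubcomplex C ∧ ∀ K L, X.IsHalfspace K → X.IsHalfspace L →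
      Cuts K C → Cuts L C → K = L ∨ K = Lᶜ ∨ Transverse K L := by
  constructor
  · intro hC
    obtain ⟨n, f, hf⟩ := exists_isChart hC
    refine ⟨hf.convexSubcomplex hX, fun K L hK hL hKC hLC => ?_⟩
    have aux : ∀ M, X.IsHalfspace M → Cuts M C → ∃ x i, M = X.side (f x) (f (flip i x)) := by
      rintro M hM ⟨⟨p, hp, hpM⟩, q, hq, hqM⟩
      rw [← hf.range_eq] at hp
      obtain ⟨x, rfl⟩ := hp
      exact ⟨x, hf.exists_eq_side hX hM hpM fun h => hqM (h hq)⟩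
    obtain ⟨x, i, rfl⟩ := aux K hK hKC
    obtain ⟨y, j, rfl⟩ := aux L hL hLC
    by_cases hij : i = j
    · subst hij
      have := hf.side_flip hX y i x
      by_cases h : x i = y i
      · rw [if_pos h] at this
        exact .inl this
      · rw [if_neg h] at this
        exact .inr (.inl this)
    · right; right
      have hq : ∀ s t : Bool, ∃ z : Fin n → Bool, z i = s ∧ z j = t := fun s t =>
        ⟨Function.update (Function.update x i s) j t, by simp [hij], by simp⟩
      have hmem : ∀ s t : Bool, ∃ z, (z ∈ X.side (f x) (f (flip i x)) ↔ s = x i) ∧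
          (z ∈ X.side (f y) (f (flip j y)) ↔ t = y j) := by
        intro s t
        obtain ⟨z, rfl, rfl⟩ := hq s t
        exact ⟨f z, hf.mem_side_iff hX x i z, hf.mem_side_iff hX y j z⟩
      obtain ⟨z₁, h1, k1⟩ := hmem (x i) (y j)
      obtain ⟨z₂, h2, k2⟩ := hmem (x i) (!y j)
      obtain ⟨z₃, h3, k3⟩ := hmem (!x i) (y j)
      obtain ⟨z₄, h4, k4⟩ := hmem (!x i) (!y j)
      refine ⟨⟨⟨z₁, h1.2 rfl, k1.2 rfl⟩, z₂, h2.2 rfl, ?_⟩, ⟨z₃, ?_, k3.2 rfl⟩, z₄, ?_, ?_⟩ <;>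
        rw [Set.mem_compl_iff] <;> simp_all
  · rintro ⟨hC, hcross⟩
    obtain ⟨x, hx⟩ := hC.1
    have hcuts : ∀ s ∈ C, X.graph.Adj x s → Cuts (X.side x s) C := fun s hs hxs =>
      ⟨⟨x, hx, left_mem_side hxs⟩, s, hs, right_notMem_side hX hxs⟩
    -- the neighbours of `x` in `C` span a cube `D`, which turns out to be `C`
    have hfin : {s | s ∈ C ∧ X.graph.Adj x s}.Finite := by
      refine ((hproper x).biUnion (t := id) fun D hD => ?_).subset ?_
      · obtain ⟨n, f, hf⟩ := exists_isChart hD.1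
        exact hf.range_eq ▸ Set.finite_range f
      · rintro s ⟨-, hs⟩
        exact Set.mem_biUnion (x := {x, s}) ⟨(adj_iff.1 hs).2, by simp⟩ (by simp)
    obtain ⟨D, hD, hxD, hN⟩ := hX.flagLinks x _ hfin (by
      rintro s ⟨hs, hxs⟩ t ⟨ht, hxt⟩
      by_cases hst : s = t
      · subst hst
        simpa using singleton_mem_link hxs
      have hK : X.IsHalfspace (X.side x s) := ⟨x, s, hxs, rfl⟩
      have hL : X.IsHalfspace (X.side x t) := ⟨x, t, hxt, rfl⟩
      rcases hcross _ _ hK hL (hcuts s hs hxs) (hcuts t ht hxt) with h | h | h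
      · have h1 : t ∉ X.side x s := h ▸ right_notMem_side hX hxt
        rw [mem_side] at h1
        have h2 := hX.dist_adj_cases t hxs
        rw [dist_eq_one hxt.symm] at h1 h2
        exact absurd (((connected hX).dist_eq_zero_iff).1 (by omega)) (Ne.symm hst)
      · have h1 : x ∈ (X.side x t)ᶜ := h ▸ left_mem_side hxs
        exact absurd (left_mem_side hxt) h1
      · obtain ⟨q, h1, h2⟩ := h.2.2
        rw [compl_side hX hxs] at h1
        rw [compl_side hX hxt] at h2
        obtain ⟨r, hs, -⟩ := hX.quadrangle hxs hxt hst h1 h2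
        exact hX.pair_mem_link hs)
    have hN' : ∀ s, s ∈ C ∧ X.graph.Adj x s ↔ s ∈ D ∧ X.graph.Adj x s := fun s =>
      Set.ext_iff.1 hN s
    obtain ⟨n, f, hf⟩ := exists_isChart hD
    suffices C = D from this ▸ hD
    apply Set.Subset.antisymm
    · intro y hy
      refine (hf.convexSubcomplex hX).mem_of_forall hX fun K hK hDK => ?_
      by_contra hyK
      have hKc := (hK.compl hX).isConvex hX
      obtain ⟨w, hw⟩ := ConvexSubcomplex.exists_isGate hX (A := C ∩ Kᶜ)
        ⟨⟨y, hy, hyK⟩, hC.isConvex.inter hKc⟩ x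
      obtain ⟨x', hadj, hx'⟩ := exists_adj_closer hX (x := x) (y := w) fun h =>
        hw.1.2 (h ▸ hDK hxD)
      have hx'C : x' ∈ C := hC.2 x hx w hw.1.1 x' (by rw [dist_eq_one hadj]; omega)
      have hx'K : x' ∈ K := hDK ((hN' x').1 ⟨hx'C, hadj⟩).1
      have hL : X.IsHalfspace (X.side x x') := ⟨x, x', hadj, rfl⟩
      have hwL : w ∉ X.side x x' := by
        rw [mem_side, SimpleGraph.dist_comm, SimpleGraph.dist_comm (u := w)]
        omega
      rcases hcross _ _ hK hL ⟨⟨x, hx, hDK hxD⟩, y, hy, hyK⟩ (hcuts x' hx'C hadj)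
        with h | h | h
      · exact right_notMem_side hX hadj (h ▸ hx'K)
      · exact (Set.mem_compl_iff _ _).1 (h ▸ hDK hxD) (left_mem_side hadj)
      · exact hwL (hw.mem (hL.isConvex hX) (left_mem_side hadj)
          (helly_three hX hC.isConvex hKc (hL.isConvex hX) ⟨y, hy, hyK⟩
            ⟨x, hx, left_mem_side hadj⟩ h.2.1))
    · intro y hy
      refine hC.mem_of_forall hX fun K hK hCK => ?_
      by_contra hyK
      rw [← hf.range_eq] at hxD
      obtain ⟨x, rfl⟩ := hxD
      obtain ⟨i, rfl⟩ := hf.exists_eq_side hX hK (hCK hx) fun h => hyK (h hy)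
      exact right_notMem_side hX (hf.adj_flip x i)
        (hCK ((hN' _).2 ⟨hf.mem _, hf.adj_flip x i⟩).1)

/-! ### Products of convex subcomplexes -/

/-- `z` is the vertex opposite to `x` in a rectangle with sides `[x, v]` and `[x, u]`: it is
separated from `x` by the hyperplanes that separate `v` or `u` from `x`. -/
def IsCorner (X : CubeComplex α) (x v u z : α) : Prop :=
  ∀ K, X.IsHalfspace K → x ∈ K → (z ∈ K ↔ v ∈ K ∧ u ∈ K)

theorem exists_isCorner (hX : X.IsCAT0) {x v u : α}
    (h : ∀ K L, X.IsHalfspace K → X.IsHalfspace L → v ∈ K → x ∉ K → u ∈ L → x ∉ L →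
      Transverse K L) : ∃ z, X.IsCorner x v u z := by
  -- Helly's theorem provides a vertex `w` in all halfspaces that contain `v` or `u` but not `x`;
  -- the corner is its gate in the convex hull of `v` and `u`
  obtain ⟨w, -, hw⟩ := helly hX ((finite_separating hX x v).union (finite_separating hX x u))
    (by rintro K (⟨hK, -⟩ | ⟨hK, -⟩) <;> exact hK.isConvex hX)
    (by
      rintro K (⟨hK, h1, h2⟩ | ⟨hK, h1, h2⟩) L (⟨hL, h3, h4⟩ | ⟨hL, h3, h4⟩)
      · exact ⟨v, h1, h3⟩
      · exact (h K L hK hL h1 h2 h3 h4).1.1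
      · exact (h L K hL hK h3 h4 h1 h2).symm.1.1
      · exact ⟨u, h1, h3⟩)
    (B := Set.univ) (fun _ _ _ _ _ _ => trivial) ⟨x, trivial⟩
    (by
      rintro K (⟨hK, h1, h2⟩ | ⟨hK, h1, h2⟩)
      · exact ⟨v, trivial, h1⟩
      · exact ⟨u, trivial, h1⟩)
  let A : Set α := {y | ∀ K, X.IsHalfspace K → v ∈ K → u ∈ K → y ∈ K}
  have hvA : v ∈ A := fun _ _ h _ => h
  have huA : u ∈ A := fun _ _ _ h => h
  obtain ⟨z, hz⟩ := ConvexSubcomplex.exists_isGate hX (A := A)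
    ⟨⟨v, hvA⟩, isConvex_of_forall hX fun y hy K hK hv hu => hy K hK fun z hz => hz K hK hv hu⟩ w
  refine ⟨z, fun K hK hxK => ⟨fun hzK => ⟨?_, ?_⟩, fun h => hz.1 K hK h.1 h.2⟩⟩
  · by_contra hv
    exact hz.mem ((hK.compl hX).isConvex hX)
      (hw _ (.inl ⟨hK.compl hX, hv, fun h' => h' hxK⟩)) ⟨v, hvA, hv⟩ hzK
  · by_contra hu
    exact hz.mem ((hK.compl hX).isConvex hX)
      (hw _ (.inr ⟨hK.compl hX, hu, fun h' => h' hxK⟩)) ⟨u, huA, hu⟩ hzK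

/-- `φ` is the product map of two convex subcomplexes `V` and `U` that meet in `x` and have the
property that all hyperplanes of `V` cross all hyperplanes of `U`. -/
structure IsProductMap (X : CubeComplex α) (V U : Set α) (x : α) (φ : α × α → α) : Prop where
  convex_left : X.ConvexSubcomplex V
  convex_right : X.ConvexSubcomplex U
  mem_left : x ∈ V
  mem_right : x ∈ U
  transverse : ∀ K L, X.IsHalfspace K → X.IsHalfspace L → Cuts K V → Cuts L U → Transverse K L
  isCorner : ∀ v ∈ V, ∀ u ∈ U, X.IsCorner x v u (φ (v, u))

theorem exists_isProductMap (hX : X.IsCAT0) {V U : Set α} {x : α} (hV : X.ConvexSubcomplex V)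
    (hU : X.ConvexSubcomplex U) (hxV : x ∈ V) (hxU : x ∈ U)
    (h : ∀ K L, X.IsHalfspace K → X.IsHalfspace L → Cuts K V → Cuts L U → Transverse K L) :
    ∃ φ, X.IsProductMap V U x φ := by
  have key : ∀ p : α × α, ∃ z, p.1 ∈ V → p.2 ∈ U → X.IsCorner x p.1 p.2 z := by
    intro p
    by_cases hp : p.1 ∈ V ∧ p.2 ∈ U
    · obtain ⟨z, hz⟩ := exists_isCorner hX (x := x) (v := p.1) (u := p.2)
        fun K L hK hL h1 h2 h3 h4 =>
          h K L hK hL ⟨⟨_, hp.1, h1⟩, x, hxV, h2⟩ ⟨⟨_, hp.2, h3⟩, x, hxU, h4⟩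
      exact ⟨z, fun _ _ => hz⟩
    · exact ⟨x, fun h1 h2 => absurd ⟨h1, h2⟩ hp⟩
  choose φ hφ using key
  exact ⟨φ, hV, hU, hxV, hxU, h, fun v hv u hu => hφ (v, u) hv hu⟩

namespace IsProductMap

variable {V U : Set α} {x : α} {φ : α × α → α}

theorem not_cuts_of_cuts (h : X.IsProductMap V U x φ) {K : Set α} (hK : X.IsHalfspace K)
    (hV : Cuts K V) : ¬ Cuts K U :=
  fun hU => not_transverse_self K (h.transverse K K hK hK hV hU)

theorem apply_mem_iff_left (hX : X.IsCAT0) (h : X.IsProductMap V U x φ) {K : Set α}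
    (hK : X.IsHalfspace K) (hU : ¬ Cuts K U) {v u : α} (hv : v ∈ V) (hu : u ∈ U) :
    φ (v, u) ∈ K ↔ v ∈ K := by
  have hx := mem_iff_of_not_cuts hU h.mem_right hu
  by_cases hxK : x ∈ K
  · have := h.isCorner v hv u hu K hK hxK
    tauto
  · have := h.isCorner v hv u hu Kᶜ (hK.compl hX) hxK
    simp only [Set.mem_compl_iff] at this
    tauto

theorem apply_mem_iff_right (hX : X.IsCAT0) (h : X.IsProductMap V U x φ) {K : Set α}
    (hK : X.IsHalfspace K) (hV : ¬ Cuts K V) {v u : α} (hv : v ∈ V) (hu : u ∈ U) :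
    φ (v, u) ∈ K ↔ u ∈ K := by
  have hx := mem_iff_of_not_cuts hV h.mem_left hv
  by_cases hxK : x ∈ K
  · have := h.isCorner v hv u hu K hK hxK
    tauto
  · have := h.isCorner v hv u hu Kᶜ (hK.compl hX) hxK
    simp only [Set.mem_compl_iff] at this
    tauto

theorem injOn (hX : X.IsCAT0) (h : X.IsProductMap V U x φ) : Set.InjOn φ (V ×ˢ U) := by
  rintro ⟨v, u⟩ ⟨hv, hu⟩ ⟨v', u'⟩ ⟨hv', hu'⟩ he
  simp only at hv hu hv' hu'
  have h1 : v = v' := by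
    by_contra hne
    obtain ⟨K, hK, h1, h2⟩ := exists_halfspace hX hne
    have hc := h.not_cuts_of_cuts hK ⟨⟨v, hv, h1⟩, v', hv', h2⟩
    rw [← h.apply_mem_iff_left hX hK hc hv hu, he, h.apply_mem_iff_left hX hK hc hv' hu'] at h1
    exact h2 h1
  have h2 : u = u' := by
    by_contra hne
    obtain ⟨K, hK, h1, h2⟩ := exists_halfspace hX hne
    have hc : ¬ Cuts K V := fun hV => h.not_cuts_of_cuts hK hV ⟨⟨u, hu, h1⟩, u', hu', h2⟩
    rw [← h.apply_mem_iff_right hX hK hc hv hu, he, h.apply_mem_iff_right hX hK hc hv' hu'] at h1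
    exact h2 h1
  rw [h1, h2]

theorem apply_base (hX : X.IsCAT0) (h : X.IsProductMap V U x φ) {v : α} (hv : v ∈ V) :
    φ (v, x) = v := by
  by_contra hne
  obtain ⟨K, hK, h1, h2⟩ := exists_halfspace hX hne
  by_cases hU : Cuts K U
  · have hV : ¬ Cuts K V := fun hV => h.not_cuts_of_cuts hK hV hU
    rw [h.apply_mem_iff_right hX hK hV hv h.mem_right,
      mem_iff_of_not_cuts hV h.mem_left hv] at h1
    exact h2 h1
  · exact h2 ((h.apply_mem_iff_left hX hK hU hv h.mem_right).1 h1)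

theorem exists_eq_apply (hX : X.IsCAT0) (h : X.IsProductMap V U x φ) {S : Set α} {z : α}
    (hS : S ⊆ φ '' (V ×ˢ U)) (hz : ∀ K, X.IsHalfspace K → S ⊆ K → z ∈ K) :
    ∃ v ∈ V, ∃ u ∈ U, z = φ (v, u) := by
  obtain ⟨v, hv⟩ := h.convex_left.exists_isGate hX z
  obtain ⟨u, hu⟩ := h.convex_right.exists_isGate hX z
  refine ⟨v, hv.1, u, hu.1, ?_⟩
  by_contra hne
  obtain ⟨K, hK, hzK, hK'⟩ := exists_halfspace hX hne
  have hKc := hK.isConvex hX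
  by_cases hV : Cuts K V
  · rw [h.apply_mem_iff_left hX hK (h.not_cuts_of_cuts hK hV) hv.1 hu.1] at hK'
    exact hK' (hv.mem hKc hzK hV.1)
  have hU : ¬ Cuts K U := by
    intro hU
    rw [h.apply_mem_iff_right hX hK hV hv.1 hu.1] at hK'
    exact hK' (hu.mem hKc hzK hU.1)
  refine hz Kᶜ (hK.compl hX) (fun y hy hyK => hK' ?_) hzK
  obtain ⟨⟨v', u'⟩, ⟨hv', hu'⟩, rfl⟩ := hS hy
  rw [h.apply_mem_iff_left hX hK hU hv.1 hu.1]
  rw [h.apply_mem_iff_left hX hK hU hv' hu'] at hyK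
  exact (mem_iff_of_not_cuts hV hv' hv.1).1 hyK

theorem convexSubcomplex_image (hX : X.IsCAT0) (h : X.IsProductMap V U x φ) {C D : Set α}
    (hC : X.ConvexSubcomplex C) (hD : X.ConvexSubcomplex D) (hCV : C ⊆ V) (hDU : D ⊆ U) :
    X.ConvexSubcomplex (φ '' (C ×ˢ D)) := by
  refine ⟨(hC.1.prod hD.1).image φ, isConvex_of_forall hX fun z hz => ?_⟩
  obtain ⟨v, hv, u, hu, rfl⟩ :=
    h.exists_eq_apply hX (Set.image_mono (Set.prod_mono hCV hDU)) hz
  refine ⟨(v, u), ⟨hC.mem_of_forall hX fun K hK hCK => ?_,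
    hD.mem_of_forall hX fun K hK hDK => ?_⟩, rfl⟩
  · by_contra hvK
    obtain ⟨c, hc⟩ := hC.1
    have hU := h.not_cuts_of_cuts hK ⟨⟨c, hCV hc, hCK hc⟩, v, hv, hvK⟩
    rw [← h.apply_mem_iff_left hX hK hU hv hu] at hvK
    refine hvK (hz K hK ?_)
    rintro _ ⟨⟨c', d'⟩, ⟨hc', hd'⟩, rfl⟩
    exact (h.apply_mem_iff_left hX hK hU (hCV hc') (hDU hd')).2 (hCK hc')
  · by_contra huK
    obtain ⟨d, hd⟩ := hD.1
    have hV : ¬ Cuts K V := fun hV => h.not_cuts_of_cuts hK hV ⟨⟨d, hDU hd, hDK hd⟩, u, hu, huK⟩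
    rw [← h.apply_mem_iff_right hX hK hV hv hu] at huK
    refine huK (hz K hK ?_)
    rintro _ ⟨⟨c', d'⟩, ⟨hc', hd'⟩, rfl⟩
    exact (h.apply_mem_iff_right hX hK hV (hCV hc') (hDU hd')).2 (hDK hd')

theorem cuts_image_iff (hX : X.IsCAT0) (h : X.IsProductMap V U x φ) {C D K : Set α}
    (hC : C.Nonempty) (hD : D.Nonempty) (hCV : C ⊆ V) (hDU : D ⊆ U) (hK : X.IsHalfspace K) :
    Cuts K (φ '' (C ×ˢ D)) ↔ Cuts K C ∨ Cuts K D := by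
  constructor
  · rintro ⟨⟨_, ⟨⟨c, d⟩, ⟨hc, hd⟩, rfl⟩, h1⟩, _, ⟨⟨c', d'⟩, ⟨hc', hd'⟩, rfl⟩, h2⟩
    rw [Set.mem_compl_iff] at h2
    by_cases hV : Cuts K V
    · have hU := h.not_cuts_of_cuts hK hV
      rw [h.apply_mem_iff_left hX hK hU (hCV hc) (hDU hd)] at h1
      rw [h.apply_mem_iff_left hX hK hU (hCV hc') (hDU hd')] at h2
      exact .inl ⟨⟨c, hc, h1⟩, c', hc', h2⟩
    · rw [h.apply_mem_iff_right hX hK hV (hCV hc) (hDU hd)] at h1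
      rw [h.apply_mem_iff_right hX hK hV (hCV hc') (hDU hd')] at h2
      exact .inr ⟨⟨d, hd, h1⟩, d', hd', h2⟩
  · rintro (hKC | hKD)
    · have hU := h.not_cuts_of_cuts hK (hKC.mono hCV)
      obtain ⟨⟨c, hc, h1⟩, c', hc', h2⟩ := hKC
      obtain ⟨d, hd⟩ := hD
      exact ⟨⟨_, ⟨(c, d), ⟨hc, hd⟩, rfl⟩,
          (h.apply_mem_iff_left hX hK hU (hCV hc) (hDU hd)).2 h1⟩,
        _, ⟨(c', d), ⟨hc', hd⟩, rfl⟩,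
          mt (h.apply_mem_iff_left hX hK hU (hCV hc') (hDU hd)).1 h2⟩
    · have hV : ¬ Cuts K V := fun hV => h.not_cuts_of_cuts hK hV (hKD.mono hDU)
      obtain ⟨⟨d, hd, h1⟩, d', hd', h2⟩ := hKD
      obtain ⟨c, hc⟩ := hC
      exact ⟨⟨_, ⟨(c, d), ⟨hc, hd⟩, rfl⟩,
          (h.apply_mem_iff_right hX hK hV (hCV hc) (hDU hd)).2 h1⟩,
        _, ⟨(c, d'), ⟨hc, hd'⟩, rfl⟩,
          mt (h.apply_mem_iff_right hX hK hV (hCV hc) (hDU hd')).1 h2⟩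

/-- A set of pairs with convex image is a product of convex sets. -/
theorem exists_eq_prod (hX : X.IsCAT0) (h : X.IsProductMap V U x φ) {S : Set (α × α)}
    (hS : S ⊆ V ×ˢ U) (hconv : X.ConvexSubcomplex (φ '' S)) :
    ∃ C D, X.ConvexSubcomplex C ∧ X.ConvexSubcomplex D ∧ C ⊆ V ∧ D ⊆ U ∧ S = C ×ˢ D := by
  have hmem : ∀ {v u : α}, v ∈ V → u ∈ U →
      (∀ K, X.IsHalfspace K → (∀ p ∈ S, φ p ∈ K) → φ (v, u) ∈ K) → (v, u) ∈ S := by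
    intro v u hv hu hK
    obtain ⟨p, hp, he⟩ := hconv.mem_of_forall hX (z := φ (v, u)) fun K hK' hSK =>
      hK K hK' fun p hp => hSK ⟨p, hp, rfl⟩
    rwa [← h.injOn hX (hS hp) ⟨hv, hu⟩ he]
  have hne : S.Nonempty := hconv.1.of_image
  have hCV : Prod.fst '' S ⊆ V := by rintro _ ⟨p, hp, rfl⟩; exact (hS hp).1
  have hDU : Prod.snd '' S ⊆ U := by rintro _ ⟨p, hp, rfl⟩; exact (hS hp).2
  have hprod : ∀ p ∈ S, ∀ q ∈ S, (p.1, q.2) ∈ S := by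
    intro p hp q hq
    refine hmem (hS hp).1 (hS hq).2 fun K hK hSK => ?_
    by_cases hV : Cuts K V
    · have hU := h.not_cuts_of_cuts hK hV
      rw [h.apply_mem_iff_left hX hK hU (hS hp).1 (hS hq).2,
        ← h.apply_mem_iff_left hX hK hU (hS hp).1 (hS hp).2]
      exact hSK p hp
    · rw [h.apply_mem_iff_right hX hK hV (hS hp).1 (hS hq).2,
        ← h.apply_mem_iff_right hX hK hV (hS hq).1 (hS hq).2]
      exact hSK q hq
  refine ⟨Prod.fst '' S, Prod.snd '' S, ⟨hne.image _, isConvex_of_forall hX fun v hv => ?_⟩,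
    ⟨hne.image _, isConvex_of_forall hX fun u hu => ?_⟩, hCV, hDU, ?_⟩
  · have hvV : v ∈ V := h.convex_left.mem_of_forall hX fun K hK hVK => hv K hK (hCV.trans hVK)
    obtain ⟨p, hp⟩ := hne
    refine ⟨(v, p.2), hmem hvV (hS hp).2 fun K hK hSK => ?_, rfl⟩
    by_cases hV : Cuts K V
    · have hU := h.not_cuts_of_cuts hK hV
      rw [h.apply_mem_iff_left hX hK hU hvV (hS hp).2]
      refine hv K hK ?_
      rintro _ ⟨q, hq, rfl⟩
      exact (h.apply_mem_iff_left hX hK hU (hS hq).1 (hS hq).2).1 (hSK q hq)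
    · rw [h.apply_mem_iff_right hX hK hV hvV (hS hp).2,
        ← h.apply_mem_iff_right hX hK hV (hS hp).1 (hS hp).2]
      exact hSK p hp
  · have huU : u ∈ U := h.convex_right.mem_of_forall hX fun K hK hUK => hu K hK (hDU.trans hUK)
    obtain ⟨p, hp⟩ := hne
    refine ⟨(p.1, u), hmem (hS hp).1 huU fun K hK hSK => ?_, rfl⟩
    by_cases hV : Cuts K V
    · have hU := h.not_cuts_of_cuts hK hV
      rw [h.apply_mem_iff_left hX hK hU (hS hp).1 huU,
        ← h.apply_mem_iff_left hX hK hU (hS hp).1 (hS hp).2]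
      exact hSK p hp
    · rw [h.apply_mem_iff_right hX hK hV (hS hp).1 huU]
      refine hu K hK ?_
      rintro _ ⟨q, hq, rfl⟩
      exact (h.apply_mem_iff_right hX hK hV (hS hq).1 (hS hq).2).1 (hSK q hq)
  · ext ⟨v, u⟩
    constructor
    · exact fun hp => ⟨⟨_, hp, rfl⟩, _, hp, rfl⟩
    · rintro ⟨⟨p, hp, rfl⟩, q, hq, rfl⟩
      exact hprod p hp q hq

theorem image_mem_cubes_iff (hX : X.IsCAT0) (hproper : X.IsProper) (h : X.IsProductMap V U x φ)
    {S : Set (α × α)} (hS : S ⊆ V ×ˢ U) :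
    φ '' S ∈ X.cubes ↔ ∃ C ∈ X.cubes, ∃ D ∈ X.cubes, S = C ×ˢ D := by
  constructor
  · intro hm
    obtain ⟨hconv, hcross⟩ := (mem_cubes_iff hX hproper).1 hm
    obtain ⟨C, D, hC, hD, hCV, hDU, rfl⟩ := h.exists_eq_prod hX hS hconv
    have hcuts := fun K => h.cuts_image_iff hX (K := K) hC.1 hD.1 hCV hDU
    refine ⟨C, (mem_cubes_iff hX hproper).2 ⟨hC, fun K L hK hL h1 h2 => ?_⟩,
      D, (mem_cubes_iff hX hproper).2 ⟨hD, fun K L hK hL h1 h2 => ?_⟩, rfl⟩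
    · exact hcross K L hK hL ((hcuts K hK).2 (.inl h1)) ((hcuts L hL).2 (.inl h2))
    · exact hcross K L hK hL ((hcuts K hK).2 (.inr h1)) ((hcuts L hL).2 (.inr h2))
  · rintro ⟨C, hC, D, hD, rfl⟩
    obtain ⟨hC, hC'⟩ := (mem_cubes_iff hX hproper).1 hC
    obtain ⟨hD, hD'⟩ := (mem_cubes_iff hX hproper).1 hD
    have hCV : C ⊆ V := fun v hv => (hS (Set.mk_mem_prod hv hD.1.some_mem)).1
    have hDU : D ⊆ U := fun u hu => (hS (Set.mk_mem_prod hC.1.some_mem hu)).2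
    refine (mem_cubes_iff hX hproper).2
      ⟨h.convexSubcomplex_image hX hC hD hCV hDU, fun K L hK hL h1 h2 => ?_⟩
    rw [h.cuts_image_iff hX hC.1 hD.1 hCV hDU hK] at h1
    rw [h.cuts_image_iff hX hC.1 hD.1 hCV hDU hL] at h2
    rcases h1 with h1 | h1 <;> rcases h2 with h2 | h2
    · exact hC' K L hK hL h1 h2
    · exact .inr (.inr (h.transverse K L hK hL (h1.mono hCV) (h2.mono hDU)))
    · exact .inr (.inr (h.transverse L K hL hK (h2.mono hCV) (h1.mono hDU)).symm)
    · exact hD' K L hK hL h1 h2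

theorem extendsToProduct (hX : X.IsCAT0) (hproper : X.IsProper) (h : X.IsProductMap V U x φ)
    {F : Set α} (hF : X.ConvexSubcomplex F) (hVF : V ⊆ F) (hUF : U ⊆ F) :
    X.ExtendsToProduct V U F := by
  refine ⟨φ, ⟨h.injOn hX, fun S hS => h.image_mem_cubes_iff hX hproper hS,
    h.convexSubcomplex_image hX h.convex_left h.convex_right subset_rfl subset_rfl, ?_⟩,
    ⟨x, h.mem_right, fun a ha => h.apply_base hX ha⟩, fun a ha => ?_⟩
  · rintro _ ⟨⟨v, u⟩, ⟨hv, hu⟩, rfl⟩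
    exact hF.mem_of_forall hX fun K hK hFK =>
      (h.isCorner v hv u hu K hK (hFK (hVF h.mem_left))).2 ⟨hFK (hVF hv), hFK (hUF hu)⟩
  · have haV : {a} ⊆ V := Set.singleton_subset_iff.2 ha
    have hconv : X.ConvexSubcomplex {a} := by
      refine ⟨⟨a, rfl⟩, isConvex_of_forall hX fun z hz => ?_⟩
      by_contra hne
      obtain ⟨K, hK, h1, h2⟩ := exists_halfspace hX (x := a) (y := z) (Ne.symm hne)
      exact h2 (hz K hK (Set.singleton_subset_iff.2 h1))
    rw [parallel_iff hX (h.convexSubcomplex_image hX hconv h.convex_right haV subset_rfl).2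
      h.convex_right.2]
    intro K hK
    rw [h.cuts_image_iff hX (Set.singleton_nonempty a) h.convex_right.1 haV subset_rfl hK,
      or_iff_right]
    rintro ⟨⟨_, rfl, h1⟩, _, rfl, h2⟩
    exact h2 h1

end IsProductMap

/-! ### Clean containers -/

/-- If the inclusion of `V` extends to a product with `W`, then all hyperplanes of `V` cross all
hyperplanes of `W`: an edge of `V` spans with each edge of `W` a square, so that the slices over
the two ends of the edge lie on different sides of its hyperplane. -/
theorem ExtendsToProduct.transverse (hX : X.IsCAT0) {V W F : Set α} (hV : X.ConvexSubcomplex V)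
    (hW : X.ConvexSubcomplex W) (h : X.ExtendsToProduct V W F) {K L : Set α}
    (hK : X.IsHalfspace K) (hL : X.IsHalfspace L) (hKW : Cuts K W) (hLV : Cuts L V) :
    Transverse K L := by
  obtain ⟨φ, hφ, ⟨w₀, hw₀, hbase⟩, hpar⟩ := h
  obtain ⟨a, ha, a', ha', hadj, haL, haL'⟩ := hLV.exists_adj hX hV.isConvex
  have hsub : ∀ {A B : Set α}, A ⊆ V → B ⊆ W → A ∈ X.cubes → B ∈ X.cubes →
      φ '' (A ×ˢ B) ∈ X.cubes := fun {A B} hA hB hA' hB' =>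
    (hφ.image_mem_cubes_iff _ (Set.prod_mono hA hB)).2 ⟨A, hA', B, hB', rfl⟩
  have hne : ∀ {p q : α × α}, p ∈ V ×ˢ W → q ∈ V ×ˢ W → p ≠ q → φ p ≠ φ q :=
    fun hp hq hpq he => hpq (hφ.injOn hp hq he)
  have haa : ({a, a'} : Set α) ⊆ V := by rintro _ (rfl | rfl) <;> assumption
  have adj₁ : ∀ w ∈ W, X.graph.Adj (φ (a, w)) (φ (a', w)) := fun w hw => by
    refine adj_iff.2 ⟨hne ⟨ha, hw⟩ ⟨ha', hw⟩ (by simp [hadj.ne]), ?_⟩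
    have := hsub haa (Set.singleton_subset_iff.2 hw) (adj_iff.1 hadj).2 (X.singleton_mem w)
    rwa [Set.prod_singleton, Set.image_image, Set.image_pair] at this
  have adj₂ : ∀ v ∈ V, ∀ w ∈ W, ∀ w' ∈ W, X.graph.Adj w w' →
      X.graph.Adj (φ (v, w)) (φ (v, w')) := fun v hv w hw w' hw' hww => by
    refine adj_iff.2 ⟨hne ⟨hv, hw⟩ ⟨hv, hw'⟩ (by simp [hww.ne]), ?_⟩
    have := hsub (Set.singleton_subset_iff.2 hv)
      (show {w, w'} ⊆ W by rintro _ (rfl | rfl) <;> assumption)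
      (X.singleton_mem v) (adj_iff.1 hww).2
    rwa [Set.singleton_prod, Set.image_image, Set.image_pair] at this
  have key : ∀ w ∈ W, L = X.side (φ (a, w)) (φ (a', w)) := by
    intro w hw
    induction hn : X.graph.dist w w₀ generalizing w with
    | zero =>
      rw [((connected hX).dist_eq_zero_iff).1 hn, hbase a ha, hbase a' ha']
      exact hL.eq_side hX hadj haL haL'
    | succ n ih =>
      obtain ⟨w', h1, h2⟩ := exists_adj_closer hX (x := w) (y := w₀) (by rintro rfl; simp at hn)
      have hw' : w' ∈ W := hW.2 w hw w₀ hw₀ w' (by rw [dist_eq_one h1]; omega)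
      rw [ih w' hw' (by omega)]
      refine side_eq_of_square hX ⟨?_, adj₁ w' hw', adj₂ a' ha' w' hw' w hw h1.symm,
        (adj₁ w hw).symm, adj₂ a ha w hw w' hw' h1, ?_, ?_⟩
      · have := hsub haa (show {w, w'} ⊆ W by rintro _ (rfl | rfl) <;> assumption)
          (adj_iff.1 hadj).2 (adj_iff.1 h1).2
        convert this using 1
        ext z
        simp only [Set.mem_insert_iff, Set.mem_singleton_iff, Set.mem_image, Set.mem_prod,
          Prod.exists]
        constructor
        · rintro (rfl | rfl | rfl | rfl)
          · exact ⟨a, w', by simp⟩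
          · exact ⟨a', w', by simp⟩
          · exact ⟨a', w, by simp⟩
          · exact ⟨a, w, by simp⟩
        · rintro ⟨_, _, ⟨rfl | rfl, rfl | rfl⟩, rfl⟩ <;> simp
      · exact hne ⟨ha, hw'⟩ ⟨ha', hw⟩ (by simp [hadj.ne])
      · exact hne ⟨ha', hw'⟩ ⟨ha, hw⟩ (by simp [hadj.ne.symm])
  have hslice : ∀ v ∈ V, Cuts K (φ '' ({v} ×ˢ W)) := by
    intro v hv
    obtain ⟨p, q, hpq, rfl⟩ := hK
    exact Crosses.cuts hX hpq
      ((hpar v hv _ ⟨p, q, hpq, rfl⟩).2 ((crosses_hyperplane_iff hX hW.isConvex hpq).2 hKW))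
  have h1 : φ '' ({a} ×ˢ W) ⊆ L := by
    rintro _ ⟨⟨_, w⟩, ⟨rfl, hw⟩, rfl⟩
    rw [key w hw]
    exact left_mem_side (adj₁ w hw)
  have h2 : φ '' ({a'} ×ˢ W) ⊆ Lᶜ := by
    rintro _ ⟨⟨_, w⟩, ⟨rfl, hw⟩, rfl⟩
    rw [key w hw]
    exact right_notMem_side hX (adj₁ w hw)
  exact Transverse.symm ⟨(hslice a ha).mono h1, (hslice a' ha').mono h2⟩

theorem cuts_inter_iff (hX : X.IsCAT0) {A B K : Set α} (hA : X.IsConvex A) (hB : X.IsConvex B)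
    (hAB : (A ∩ B).Nonempty) (hK : X.IsHalfspace K) :
    Cuts K (A ∩ B) ↔ Cuts K A ∧ Cuts K B :=
  ⟨fun h => ⟨h.mono Set.inter_subset_left, h.mono Set.inter_subset_right⟩, fun ⟨h1, h2⟩ =>
    ⟨helly_three hX hA hB (hK.isConvex hX) hAB h1.1 h2.1,
      helly_three hX hA hB ((hK.compl hX).isConvex hX) hAB h1.2 h2.2⟩⟩

theorem Crosses.mono {H : Set (Sym2 α)} {A B : Set α} (h : Crosses H A) (hAB : A ⊆ B) :
    Crosses H B := by
  obtain ⟨a, ha, b, hb, hab⟩ := h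
  exact ⟨a, hAB ha, b, hAB hb, hab⟩

theorem ParallelInto.crosses {A B : Set α} (h : X.ParallelInto A B) {H : Set (Sym2 α)}
    (hH : H ∈ X.hyperplanes) (hA : Crosses H A) : Crosses H B := by
  obtain ⟨B', hB', -, hpar⟩ := h
  exact ((hpar H hH).1 hA).mono hB'

theorem IsCleanContainer.parallel {F V U U' : Set α} (h : X.IsCleanContainer F V U)
    (h' : X.IsCleanContainer F V U') : X.Parallel U' U := fun _ hH =>
  ⟨(h.maximal U' h'.mem h'.subset h'.extends_product).crosses hH,
    (h'.maximal U h.mem h.subset h.extends_product).crosses hH⟩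

/-- The part of the orthogonal complement of `V` that lies in `F` is a clean container. -/
theorem isCleanContainer_orthogonal_inter (hX : X.IsCAT0) (hproper : X.IsProper)
    (hfactor : X.HasFactorSystem) {F V : Set α} (hF : F ∈ X.hyperclosure)
    (hV : V ∈ X.hyperclosure) (hVF : V ⊆ F) {x : α} (hx : x ∈ V) :
    X.IsCleanContainer F V (X.orthogonal V x ∩ F) := by
  have hc := isHyperclosed_hyperclosure hX
  have hFc := hc.convex _ hF
  have hVc := hc.convex _ hV
  have hO := convexSubcomplex_orthogonal hX V x
  have hxO := self_mem_orthogonal (X := X) V x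
  have hcuts := fun K => cuts_inter_iff hX (K := K) hO.isConvex hFc.isConvex ⟨x, hxO, hVF hx⟩
  have hU : X.ConvexSubcomplex (X.orthogonal V x ∩ F) :=
    ⟨⟨x, hxO, hVF hx⟩, hO.isConvex.inter hFc.isConvex⟩
  refine ⟨?_, Set.inter_subset_right, ?_, fun W hW hWF hext => ?_⟩
  · have hO' := orthogonal_mem_hyperclosure hX hfactor hx
    have hg := hc.gateImage_mem _ hF _ hO'
    refine hc.parallel_mem _ hg _ hU
      ((parallel_iff hX hU.isConvex (hc.convex _ hg).isConvex).2 fun K hK => ?_)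
    rw [hcuts K hK, cuts_gateImage_iff hX hFc hK, and_comm]
  · obtain ⟨φ, hφ⟩ := exists_isProductMap hX hVc hU hx ⟨hxO, hVF hx⟩ fun K L hK hL hKV hLU =>
      ((cuts_orthogonal_iff hX hx hL).1 ((hcuts L hL).1 hLU).1 K hK hKV).symm
    exact hφ.extendsToProduct hX hproper hFc hVF Set.inter_subset_right
  · have hWc := hc.convex _ hW
    have hg := convexSubcomplex_gateImage hX hU hWc
    refine ⟨_, gateImage_subset _ W, hg,
      (parallel_iff hX hWc.isConvex hg.isConvex).2 fun K hK => ?_⟩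
    rw [cuts_gateImage_iff hX hU hK, hcuts K hK, cuts_orthogonal_iff hX hx hK]
    exact ⟨fun hKW => ⟨⟨fun L hL hLV => hext.transverse hX hVc hWc hK hL hKW hLV,
      hKW.mono hWF⟩, hKW⟩, And.right⟩

end CubeComplex

theorem theoremC {α : Type*} (X : CubeComplex α) (hX : X.IsCAT0) (hproper : X.IsProper)
    {G : Type*} [Group G] [MulAction G α] (hG : X.ActsGeometrically G)
    (hfactor : X.HasFactorSystem)
    (F : Set α) (hF : F ∈ X.hyperclosure) (V : Set α) (hV : V ∈ X.hyperclosure)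
    (hVF : V ⊂ F) :
    ∃ U : Set α, X.IsCleanContainer F V U ∧
      ∀ U' : Set α, X.IsCleanContainer F V U' → X.Parallel U' U := by
  obtain ⟨x, hx⟩ := ((CubeComplex.isHyperclosed_hyperclosure hX).convex _ hV).1
  have h := CubeComplex.isCleanContainer_orthogonal_inter hX hproper hfactor hF hV hVF.subset hx
  exact ⟨_, h, fun U' h' => h.parallel h'⟩
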